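/- Notation. Let $\mathcal P=\mathbb R_+^F$, and for a unit vector $\mathbf u\in\mathcal P$ and $\alpha\in(0,\pi/2)$ let $\mathcal C(\mathbf u,\alpha)=\{\mathbf x\in\mathbb R^F\setminus\{0\}:\mathbf x^T\mathbf u/\|\mathbf x\|_2\ge\cos\alpha\}$ be the circular cone with basis vector $\mathbf u$ and size angle $\alpha$. Given cones $C_k=\mathcal C(\mathbf u_k,\alpha_k)$ and parameters $\lambda_k>0$, $k\in[K]$, the columns of the random matrix $\mathbf V\in\mathbb R^{F\times N}$ are generated independently, each as follows: (1) sample $k\in[K]$ uniformly; (2) sample $l$ from the exponential distribution with density $\lambda_k e^{-\lambda_k x}$, $x\ge 0$; (3) sample an angle $\theta$ uniformly from $[0,\alpha_k]$ and then a vector $\mathbf z$ uniformly from $\{\mathbf x:\|\mathbf x\|_2=1,\ \mathbf x^T\mathbf u_k=\cos\theta\}$, independently of $l$; (4) if $\mathbf z\notin\mathcal P$, set the negative entries of $\mathbf z$ to zero and rescale to unit length; (5) the column is $\sqrt l\,\mathbf z$. Let $\sigma_j(\mathbf V)$ be the $j$-th largest singular value of $\mathbf V$, $f(\alpha)=\frac12-\frac{\sin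 2\alpha}{4\alpha}$ and $g(\alpha)=\frac12+\frac{\sin 2\alpha}{4\alpha}$. Theorem. Let $\lambda>0$, $\alpha\in(0,\pi/2)$ and $\beta\in\mathbb R$. There is a constant $c>0$, depending only on $\lambda,\alpha,\beta$, such that the following holds. Let $\mathbf V\in\mathbb R^{F\times N}$ be generated by the above process from $K$ cones with $\alpha_k=\alpha$ and $\lambda_k=\lambda$ for all $k$, with $\arccos(\mathbf u_i^T\mathbf u_j)=\beta$ for all $i\ne j$, and with all the cones contained in $\mathcal P$. Let $1<K_{\min}\le K\le K_{\max}<F$. Put $a=\frac{f(\alpha)/\lambda}{F-1}$ and $b=\frac{g(\alpha)-f(\alpha)/(F-1)}{K\lambda}$, let $t\ge 1$, and let $\epsilon$ satisfy $$0<\epsilon<a\quad\text{and}\quad \frac{a+\epsilon}{a-\epsilon}<\frac{a+b(1-\cos\beta)-\epsilon}{a+\epsilon}.$$ If $N\ge c(t/\epsilon)^2F$, then with probability at least $1-2(K_{\max}-K_{\min}+1)\exp(-t^2F)$ one has $K_{\max}<\operatorname{rank}(\mathbf V)$ and $$\frac{\sigma_K(\mathbf V)}{\sigma_{K+1}(\mathbf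 V)}=\max_{j\in\{K_{\min},\ldots,K_{\max}\}}\frac{\sigma_j(\mathbf V)}{\sigma_{j+1}(\mathbf V)},$$ and $K$ is the only maximizer, so that the estimator $\hat K=\arg\max_{k\in\{K_{\min},\ldots,K_{\max}\}}\sigma_k(\mathbf V)/\sigma_{k+1}(\mathbf V)$ equals $K$. -/

import Mathlib

open MeasureTheory ProbabilityTheory

open scoped ENNReal InnerProductSpace

noncomputable section

namespace ConeNMF

/-- The nonnegative orthant of `ℝ^F`. -/
def orthant (F : ℕ) : Set (EuclideanSpace ℝ (Fin F)) := {x | ∀ i, 0 ≤ x i}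

/-- The circular cone with basis vector `u` (a unit vector) and size angle `α`. -/
def circularCone {F : ℕ} (u : EuclideanSpace ℝ (Fin F)) (α : ℝ) :
    Set (EuclideanSpace ℝ (Fin F)) :=
  {x | x ≠ 0 ∧ Real.cos α ≤ ⟪x, u⟫_ℝ / ‖x‖}

/-- The uniform probability measure on the unit sphere of a finite-dimensional inner product
space `E`, as a measure on `E`: normalized surface measure. On a one-dimensional space it gives
mass `1/2` to each of the two unit vectors. -/
def uniformOnSphere (E : Type*) [NormedAddCommGroup E] [InnerProductSpace ℝ E]
    [FiniteDimensional ℝ E] [MeasurableSpace E] [BorelSpace E] : Measure E :=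
  (((volume : Measure E).toSphere Set.univ)⁻¹ • (volume : Measure E).toSphere).map Subtype.val

/-- The law of a unit vector sampled uniformly from the cone of `u` and `α` with respect to the
angle: first an angle `b` uniform on `[0, α]`, then, independently of `b`, a unit vector `y`
uniform on the unit sphere of the orthogonal complement of `u`; the sample is
`cos b • u + sin b • y`, which is uniform on `{x | ‖x‖ = 1, ⟪x, u⟫ = cos b}` given `b`. -/
def coneDirectionLaw {F : ℕ} (u : EuclideanSpace ℝ (Fin F)) (α : ℝ) :
    Measure (EuclideanSpace ℝ (Fin F)) :=
  ((cond (volume : Measure ℝ) (Set.Icc 0 α)).prod (uniformOnSphere (ℝ ∙ u)ᗮ)).map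
    (fun p => Real.cos p.1 • u + Real.sin p.1 • (p.2 : EuclideanSpace ℝ (Fin F)))

open scoped Classical in
/-- If `z` is not nonnegative, set its negative entries to zero and rescale to unit length;
otherwise keep `z`. -/
def clipToOrthant {F : ℕ} (z : EuclideanSpace ℝ (Fin F)) : EuclideanSpace ℝ (Fin F) :=
  if z ∈ orthant F then z
  else
    let w : EuclideanSpace ℝ (Fin F) := WithLp.toLp 2 (fun i => max (z i) 0)
    ‖w‖⁻¹ • w

/-- The law of a column generated from a single cone: `√l • z`, where the squared length `l` is
exponential with parameter `lam` and `z` is the (clipped) direction, independent of `l`. -/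
def coneColumnLaw {F : ℕ} (u : EuclideanSpace ℝ (Fin F)) (α lam : ℝ) :
    Measure (EuclideanSpace ℝ (Fin F)) :=
  ((expMeasure lam).prod (coneDirectionLaw u α)).map (fun p => √p.1 • clipToOrthant p.2)

/-- The law of a column of the data matrix: a cone index is chosen uniformly among the `K`
cones, then the column is generated from that cone. -/
def columnLaw {F K : ℕ} (u : Fin K → EuclideanSpace ℝ (Fin F)) (α lam : Fin K → ℝ) :
    Measure (EuclideanSpace ℝ (Fin F)) :=
  (K : ℝ≥0∞)⁻¹ • ∑ k, coneColumnLaw (u k) (α k) (lam k)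

/-- The `F × N` matrix with columns `v n`. -/
def dataMatrix {F N : ℕ} (v : Fin N → EuclideanSpace ℝ (Fin F)) : Matrix (Fin F) (Fin N) ℝ :=
  Matrix.of fun i n => v n i

/-- The columns `v n` of the random data matrix are independent, and each follows the generative
process of the cones with basis vectors `u k`, size angles `α k` and parameters `lam k`. -/
structure IsGenerated {Ω : Type*} [MeasurableSpace Ω] (μ : Measure Ω) {F K N : ℕ}
    (u : Fin K → EuclideanSpace ℝ (Fin F)) (α lam : Fin K → ℝ)
    (v : Fin N → Ω → EuclideanSpace ℝ (Fin F)) : Prop where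
  indep : iIndepFun v μ
  hasLaw : ∀ n, HasLaw (v n) (columnLaw u α lam) μ

/-- `σ_j(V)`, the `j`-th largest singular value, `j = 1, 2, …` (Mathlib counts from `0`). -/
def sigma {F N : ℕ} (V : Matrix (Fin F) (Fin N) ℝ) (j : ℕ) : ℝ :=
  (Matrix.toEuclideanLin V).singularValues (j - 1)

/-- The ratio `σ_j(V) / σ_{j+1}(V)`. -/
def svRatio {F N : ℕ} (V : Matrix (Fin F) (Fin N) ℝ) (j : ℕ) : ℝ :=
  sigma V j / sigma V (j + 1)

/-- The set of maximizers of `σ_k(V) / σ_{k+1}(V)` over `k ∈ {Kmin, …, Kmax}`, that is, the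
possible values of the estimator `argmax` of the number of cones. -/
def ratioArgmax {F N : ℕ} (V : Matrix (Fin F) (Fin N) ℝ) (Kmin Kmax : ℕ) : Set ℕ :=
  {k | k ∈ Set.Icc Kmin Kmax ∧ ∀ j ∈ Set.Icc Kmin Kmax, svRatio V j ≤ svRatio V k}

/-- `f(α) = 1/2 - sin(2α)/(4α)`. -/
def fAngle (α : ℝ) : ℝ := 1 / 2 - Real.sin (2 * α) / (4 * α)

/-- `g(α) = 1/2 + sin(2α)/(4α)`. -/
def gAngle (α : ℝ) : ℝ := 1 / 2 + Real.sin (2 * α) / (4 * α)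

/-- `a = (f(α)/λ) / (F - 1)`. -/
def aCoef (F : ℕ) (α lam : ℝ) : ℝ := fAngle α / lam / ((F : ℝ) - 1)

/-- `b = (g(α) - f(α)/(F - 1)) / (K λ)`. -/
def bCoef (F K : ℕ) (α lam : ℝ) : ℝ :=
  (gAngle α - fAngle α / ((F : ℝ) - 1)) / ((K : ℝ) * lam)

/-- The smallness condition on `ε`:
`0 < ε < a` and `(a + ε)/(a - ε) < (a + b(1 - cos β) - ε)/(a + ε)`. -/
def SmallEps (F K : ℕ) (α β lam ε : ℝ) : Prop :=
  0 < ε ∧ ε < aCoef F α lam ∧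
    (aCoef F α lam + ε) / (aCoef F α lam - ε) <
      (aCoef F α lam + bCoef F K α lam * (1 - Real.cos β) - ε) / (aCoef F α lam + ε)

end ConeNMF

end

/-! Write `γ = cos β`. The mean of `v vᵀ` for one column is `M = a I + b ∑ u_k u_kᵀ`. The Gram
matrix of the `u_k` is `(1 - γ) I + γ J`, with `J` the all-ones matrix, so `M` has one top
eigenvalue, then `δ + a` with `δ = b (1 - γ)` repeated `K - 1` times, then `a` repeated `F - K`
times. If `V Vᵀ / N` is within `ε` of `M` as a quadratic form, min-max places every `σ_j² / N`
within `ε` of its eigenvalue. Ratios inside the two plateaus are then at most `√((a + ε)/(a - ε))`,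
while the ratio at `K` is at least `√((a + δ - ε)/(a + ε))`; the condition on `ε` separates the two.
The ratio of the top eigenvalue to the plateau is excluded by `1 < Kmin`. The uniform approximation
comes from a Chernoff bound at each point of a `1/2`-net of the sphere
(`measureReal_abs_sum_sub_ge_le`, `exists_half_net_sphere`) and the passage from net to sphere
(`abs_bilin_self_le_of_half_net`). The moment generating function is explicit because, given the
direction, `⟪v, x⟫²` is a multiple of an exponential variable. The deterministic half is
`ratioArgmax_eq_of_abs_sum_inner_sq_sub_le`. -/

namespace LinearMap

/-! ### Min-max bounds for singular values -/

variable {E F : Type*} [NormedAddCommGroup E] [InnerProductSpace ℝ E] [FiniteDimensional ℝ E]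
  [NormedAddCommGroup F] [InnerProductSpace ℝ F] [FiniteDimensional ℝ F]

/-- An orthonormal basis of right singular vectors. -/
theorem exists_orthonormalBasis_norm_sq_eq_sum (T : E →ₗ[ℝ] F) :
    ∃ b : OrthonormalBasis (Fin (Module.finrank ℝ E)) ℝ E,
      ∀ x, ‖T x‖ ^ 2 = ∑ i : Fin (Module.finrank ℝ E), T.singularValues i ^ 2 * ⟪b i, x⟫_ℝ ^ 2 := by
  refine ⟨T.isSymmetric_adjoint_comp_self.eigenvectorBasis rfl, fun x => ?_⟩
  set b := T.isSymmetric_adjoint_comp_self.eigenvectorBasis rfl with hb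
  have h1 : ‖T x‖ ^ 2 = ⟪(adjoint T ∘ₗ T) x, x⟫_ℝ := by
    rw [comp_apply, adjoint_inner_left, real_inner_self_eq_norm_sq]
  rw [h1, ← b.sum_inner_mul_inner]
  refine Finset.sum_congr rfl fun i _ => ?_
  have h2 : ⟪(adjoint T ∘ₗ T) x, b i⟫_ℝ = T.singularValues i ^ 2 * ⟪b i, x⟫_ℝ := by
    rw [T.isSymmetric_adjoint_comp_self x (b i), hb,
      T.isSymmetric_adjoint_comp_self.apply_eigenvectorBasis rfl i, inner_smul_right,
      T.sq_singularValues_fin rfl i, real_inner_comm]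
    rfl
  rw [h2]; ring

/-- Dimension count: `W` is too large to avoid the orthogonal complement of the first `j` right
singular vectors, and there `T` stretches by at most the singular value of index `j`. -/
theorem le_singularValues_of_forall_mem (T : E →ₗ[ℝ] F) {s : ℝ} {j : ℕ} (W : Submodule ℝ E)
    (hj : j < Module.finrank ℝ W) (h : ∀ x ∈ W, s * ‖x‖ ≤ ‖T x‖) : s ≤ T.singularValues j := by
  obtain ⟨b, hb⟩ := T.exists_orthonormalBasis_norm_sq_eq_sum
  have hn : j < Module.finrank ℝ E := hj.trans_le W.finrank_le
  let φ : W →ₗ[ℝ] (Fin j → ℝ) :=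
    LinearMap.pi fun i => (innerSL ℝ (b ⟨i, i.2.trans hn⟩)).toLinearMap ∘ₗ W.subtype
  obtain ⟨x, hx0, hx⟩ : ∃ x : W, x ≠ 0 ∧ φ x = 0 := by
    have := ker_ne_bot_of_finrank_lt (f := φ) (by simpa using hj)
    obtain ⟨x, hx, hx0⟩ := Submodule.exists_mem_ne_zero_of_ne_bot this
    exact ⟨x, hx0, hx⟩
  have hx0' : 0 < ‖(x : E)‖ := by simpa using hx0
  have horth : ∀ i : Fin (Module.finrank ℝ E), (i : ℕ) < j → ⟪b i, (x : E)⟫_ℝ = 0 := fun i hi => by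
    simpa [φ] using congrFun hx ⟨i, hi⟩
  have key : ‖T x‖ ^ 2 ≤ (T.singularValues j * ‖(x : E)‖) ^ 2 := by
    rw [hb, mul_pow, ← b.sum_sq_inner_right, Finset.mul_sum]
    refine Finset.sum_le_sum fun i _ => ?_
    rcases lt_or_ge (i : ℕ) j with hi | hi
    · simp [horth i hi]
    · gcongr
      · exact T.singularValues_nonneg _
      · exact T.singularValues_antitone hi
  have := (h x x.2).trans
    (abs_le_of_sq_le_sq' key (mul_nonneg (T.singularValues_nonneg _) hx0'.le)).2
  exact le_of_mul_le_mul_right this hx0'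

/-- Dual count: the span of the first `j + 1` right singular vectors meets the kernel of `φ`. Giving
the subspace by at most `j` linear equations avoids computing its dimension. -/
theorem singularValues_le_of_forall_ker {G : Type*} [AddCommGroup G] [Module ℝ G]
    [FiniteDimensional ℝ G] (T : E →ₗ[ℝ] F) {s : ℝ} (hs : 0 ≤ s) {j : ℕ} (φ : E →ₗ[ℝ] G)
    (hj : Module.finrank ℝ G ≤ j) (h : ∀ x, φ x = 0 → ‖T x‖ ≤ s * ‖x‖) :
    T.singularValues j ≤ s := by
  rcases le_or_gt (Module.finrank ℝ E) j with hn | hn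
  -- Beyond the dimension the singular values are `0` by convention; this is where `0 ≤ s` is
  -- needed.
  · rwa [T.singularValues_of_finrank_le hn]
  obtain ⟨b, hb⟩ := T.exists_orthonormalBasis_norm_sq_eq_sum
  let ι : Fin (j + 1) → Fin (Module.finrank ℝ E) := Fin.castLE hn
  let ψ : (Fin (j + 1) → ℝ) →ₗ[ℝ] E := Fintype.linearCombination ℝ (b ∘ ι)
  obtain ⟨c, hc0, hc⟩ : ∃ c, c ≠ 0 ∧ (φ ∘ₗ ψ) c = 0 := by
    have := ker_ne_bot_of_finrank_lt (f := φ ∘ₗ ψ) (by simpa using Nat.lt_succ_of_le hj)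
    obtain ⟨x, hx, hx0⟩ := Submodule.exists_mem_ne_zero_of_ne_bot this
    exact ⟨x, hx0, hx⟩
  have hli : LinearIndependent ℝ (b ∘ ι) :=
    b.orthonormal.linearIndependent.comp ι (Fin.castLE_injective hn)
  have hx0 : ψ c ≠ 0 := fun h0 => hc0 <| by
    have hinj : Function.Injective ψ := linearIndependent_iff_injective_fintypeLinearCombination.1 hli
    exact hinj (by simpa using h0)
  have horth : ∀ i : Fin (Module.finrank ℝ E), j < (i : ℕ) → ⟪b i, ψ c⟫_ℝ = 0 := fun i hi => by
    simp only [ψ, Fintype.linearCombination_apply, inner_sum, inner_smul_right]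
    refine Finset.sum_eq_zero fun k _ => ?_
    have hne : i ≠ ι k := fun he => by
      have := k.2
      have h3 : (i : ℕ) = k := by simp [he, ι]
      omega
    simp [b.orthonormal.2 hne]
  have key : (T.singularValues j * ‖ψ c‖) ^ 2 ≤ ‖T (ψ c)‖ ^ 2 := by
    rw [hb, mul_pow, ← b.sum_sq_inner_right, Finset.mul_sum]
    refine Finset.sum_le_sum fun i _ => ?_
    rcases lt_or_ge j (i : ℕ) with hi | hi
    · simp [horth i hi]
    · gcongr
      · exact T.singularValues_nonneg _
      · exact T.singularValues_antitone hi
  have := (abs_le_of_sq_le_sq' key (norm_nonneg _)).2.trans (h _ hc)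
  exact le_of_mul_le_mul_right this (norm_pos_iff.2 hx0)

/-- The data give a quadratic form `‖Vᵀ x‖²` on the target space, so the bounds are wanted for the
adjoint. For `y = T* x`, Cauchy–Schwarz gives `‖y‖² ≤ ‖T y‖ ‖x‖`, hence the lower bound passes from
`W` to its image; `0 < s` keeps the dimension. -/
theorem le_singularValues_of_adjoint (T : E →ₗ[ℝ] F) {s : ℝ} (hs : 0 < s) {j : ℕ}
    (W : Submodule ℝ F) (hj : j < Module.finrank ℝ W)
    (h : ∀ x ∈ W, s * ‖x‖ ≤ ‖adjoint T x‖) : s ≤ T.singularValues j := by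
  have hinj : Function.Injective ((adjoint T).domRestrict W) := by
    rw [← ker_eq_bot, ker_eq_bot']
    intro x hx
    have h1 := h x x.2
    have h2 : adjoint T x = 0 := hx
    rw [h2, norm_zero] at h1
    have h3 : ‖(x : F)‖ ≤ 0 := by nlinarith [norm_nonneg (x : F)]
    simpa using h3
  refine T.le_singularValues_of_forall_mem (range ((adjoint T).domRestrict W)) ?_ ?_
  · rwa [finrank_range_of_inj hinj]
  · rintro _ ⟨x, rfl⟩
    change s * ‖adjoint T x‖ ≤ ‖T (adjoint T x)‖
    rcases eq_or_ne (x : F) 0 with hx | hx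
    · simp [hx]
    have hx' := norm_pos_iff.2 hx
    have h1 : ‖adjoint T x‖ ^ 2 ≤ ‖T (adjoint T x)‖ * ‖(x : F)‖ := by
      rw [← real_inner_self_eq_norm_sq, adjoint_inner_right]
      exact real_inner_le_norm _ _
    have h2 := mul_le_mul_of_nonneg_right (h x x.2) (norm_nonneg (adjoint T x))
    refine le_of_mul_le_mul_right ?_ hx'
    nlinarith

theorem singularValues_le_of_adjoint {G : Type*} [AddCommGroup G] [Module ℝ G]
    [FiniteDimensional ℝ G] (T : E →ₗ[ℝ] F) {s : ℝ} (hs : 0 ≤ s) {j : ℕ} (φ : F →ₗ[ℝ] G)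
    (hj : Module.finrank ℝ G ≤ j) (h : ∀ x, φ x = 0 → ‖adjoint T x‖ ≤ s * ‖x‖) :
    T.singularValues j ≤ s := by
  refine T.singularValues_le_of_forall_ker hs (φ ∘ₗ T) hj fun y hy => ?_
  rcases eq_or_ne (T y) 0 with h0 | h0
  · rw [h0, norm_zero]; positivity
  have h1 : ‖T y‖ ^ 2 ≤ ‖adjoint T (T y)‖ * ‖y‖ := by
    rw [← real_inner_self_eq_norm_sq, ← adjoint_inner_left]
    exact real_inner_le_norm _ _
  have h2 := mul_le_mul_of_nonneg_right (h (T y) hy) (norm_nonneg y)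
  refine le_of_mul_le_mul_right ?_ (norm_pos_iff.2 h0)
  nlinarith

end LinearMap

/-! ### Nets on the sphere -/

/-- The unit sphere of an `n`-dimensional space has a `1/2`-net of at most `5 ^ n` points. -/
theorem exists_half_net_sphere (E : Type*) [NormedAddCommGroup E] [NormedSpace ℝ E]
    [FiniteDimensional ℝ E] :
    ∃ s : Finset E, s.card ≤ 5 ^ Module.finrank ℝ E ∧ (∀ y ∈ s, ‖y‖ = 1) ∧
      ∀ x : E, ‖x‖ = 1 → ∃ y ∈ s, ‖x - y‖ < 1 / 2 := by
  classical
  let P : Finset E → Prop := fun s =>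
    (∀ y ∈ s, ‖y‖ = 1) ∧ ∀ y ∈ s, ∀ z ∈ s, y ≠ z → 1 / 2 ≤ ‖y - z‖
  have hcard : ∀ s, P s → s.card ≤ 5 ^ Module.finrank ℝ E := fun s hs => by
    -- Doubling turns a `1/2`-separated subset of the unit sphere into a `1`-separated subset of the
    -- ball of radius `2`, the setting of the Besicovitch count. The net is a separated set of
    -- maximal cardinality.
    have hinj : Function.Injective fun y : E => (2 : ℝ) • y :=
      smul_right_injective E two_ne_zero
    rw [← Finset.card_image_of_injective s hinj]
    refine Besicovitch.card_le_of_separated _ ?_ ?_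
    · simp only [Finset.forall_mem_image]
      intro y hy
      rw [norm_smul, hs.1 y hy]; norm_num
    · simp only [Finset.forall_mem_image]
      intro y hy z hz hne
      have h := hs.2 y hy z hz fun h => hne (by rw [h])
      rw [← smul_sub, norm_smul, Real.norm_two]
      linarith
  obtain ⟨m, ⟨s, hs, rfl⟩, hmax⟩ : ∃ m, (∃ s, P s ∧ s.card = m) ∧
      ∀ s, P s → s.card ≤ m := by
    have hne : ∃ m, ∃ s, P s ∧ s.card = m := ⟨0, ∅, ⟨by simp, by simp⟩, rfl⟩
    have hb : ∀ m, (∃ s, P s ∧ s.card = m) → m ≤ 5 ^ Module.finrank ℝ E := by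
      rintro m ⟨s, hs, rfl⟩; exact hcard s hs
    refine ⟨Nat.findGreatest (fun m => ∃ s, P s ∧ s.card = m) (5 ^ Module.finrank ℝ E), ?_, ?_⟩
    · obtain ⟨m, hm⟩ := hne
      exact Nat.findGreatest_spec (P := fun m => ∃ s, P s ∧ s.card = m) (hb m hm) hm
    · intro s hs
      exact Nat.le_findGreatest (hcard s hs) ⟨s, hs, rfl⟩
  refine ⟨s, hcard s hs, hs.1, fun x hx => ?_⟩
  by_contra! hfar
  have hxs : x ∉ s := fun h => by
    have := hfar x h
    norm_num at this
  have := hmax (insert x s) ⟨by simpa [hx] using hs.1, ?_⟩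
  · rw [Finset.card_insert_of_notMem hxs] at this; omega
  · intro y hy z hz hne
    rcases Finset.mem_insert.1 hy with hy' | hy' <;> rcases Finset.mem_insert.1 hz with hz' | hz'
    · exact absurd (hy'.trans hz'.symm) hne
    · rw [hy']; exact hfar z hz'
    · rw [hz', norm_sub_rev]; exact hfar y hy'
    · exact hs.2 y hy' z hz' hne

/-- A symmetric bilinear form bounded by `δ` on a `1/2`-net of the sphere is bounded by `32 δ`. -/
theorem abs_bilin_self_le_of_half_net {E : Type*} [NormedAddCommGroup E] [InnerProductSpace ℝ E]
    [FiniteDimensional ℝ E] (B : E →ₗ[ℝ] E →ₗ[ℝ] ℝ) (hB : ∀ x y, B x y = B y x) (s : Set E)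
    (hs : ∀ y ∈ s, ‖y‖ = 1) (hnet : ∀ x : E, ‖x‖ = 1 → ∃ y ∈ s, ‖x - y‖ < 1 / 2)
    {δ : ℝ} (hδ : ∀ y ∈ s, |B y y| ≤ δ) (x : E) : |B x x| ≤ 32 * δ * ‖x‖ ^ 2 := by
  rcases eq_or_ne x 0 with rfl | hx
  · simp
  have hx' := norm_pos_iff.2 hx
  have hcont : Continuous fun x => |B x x| := by
    have h1 : Continuous fun x => LinearMap.toContinuousLinearMap (B x) :=
      (LinearMap.toContinuousLinearMap.toLinearMap ∘ₗ B).continuous_of_finiteDimensional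
    exact (h1.clm_apply continuous_id).abs
  obtain ⟨x₀, hx₀, hmax⟩ := (isCompact_sphere (0 : E) 1).exists_isMaxOn
    ⟨‖x‖⁻¹ • x, by simp [norm_smul, hx'.ne']⟩ hcont.continuousOn
  set M := |B x₀ x₀| with hM
  have hMb : ∀ z, |B z z| ≤ M * ‖z‖ ^ 2 := fun z => by
    rcases eq_or_ne z 0 with rfl | hz
    · simp
    have hz' := norm_pos_iff.2 hz
    have h1 : |B (‖z‖⁻¹ • z) (‖z‖⁻¹ • z)| ≤ M :=
      hmax (a := ‖z‖⁻¹ • z) (by simp [norm_smul, hz'.ne'])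
    have h2 : B (‖z‖⁻¹ • z) (‖z‖⁻¹ • z) = B z z / ‖z‖ ^ 2 := by
      simp only [map_smul, LinearMap.smul_apply, smul_eq_mul]
      field_simp
    rwa [h2, abs_div, abs_of_pos (by positivity : 0 < ‖z‖ ^ 2), div_le_iff₀ (by positivity)] at h1
  have hM0 : 0 ≤ M := abs_nonneg _
  have hx₀' : ‖x₀‖ = 1 := by simpa using hx₀
  obtain ⟨y, hy, hxy⟩ := hnet x₀ hx₀'
  have hy1 := hs y hy
  set p := x₀ - y
  set r := x₀ + y
  have hpr : ‖p‖ ^ 2 + ‖r‖ ^ 2 = 4 := by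
    have := parallelogram_law_with_norm ℝ x₀ y
    rw [hx₀', hy1] at this
    simp only [p, r]; nlinarith
  -- Polarization with `p` rescaled by `k`. Unscaled (`k = 1`) it would only give `2 M`; the best
  -- `k` is `‖r‖ / ‖p‖`, which is `√15` when `‖p‖ = 1/2`, hence `k = 4` below.
  have hmix : ∀ k : ℝ, 0 < k → |B p r| ≤ M * (k ^ 2 * ‖p‖ ^ 2 + ‖r‖ ^ 2) / (2 * k) := fun k hk => by
    have h1 := hMb (k • p + r)
    have h2 := hMb (k • p - r)
    have h3 := parallelogram_law_with_norm ℝ (k • p) r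
    have h4 : 4 * k * B p r = B (k • p + r) (k • p + r) - B (k • p - r) (k • p - r) := by
      simp only [map_add, map_sub, map_smul, LinearMap.add_apply, LinearMap.sub_apply,
        LinearMap.smul_apply, smul_eq_mul, hB r p]
      ring
    have h5 : ‖k • p‖ = k * ‖p‖ := by rw [norm_smul, Real.norm_of_nonneg hk.le]
    rw [le_div_iff₀ (by positivity)]
    have h6 : |4 * k * B p r| ≤ M * ‖k • p + r‖ ^ 2 + M * ‖k • p - r‖ ^ 2 := by
      rw [h4]; exact (abs_sub _ _).trans (add_le_add h1 h2)
    rw [abs_mul, abs_of_pos (by positivity : 0 < 4 * k)] at h6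
    rw [h5] at h3
    nlinarith
  have hdiff : B x₀ x₀ - B y y = B p r := by
    simp only [p, r, map_add, map_sub, LinearMap.sub_apply, hB y x₀]
    ring
  -- As `‖r‖² = 4 - ‖p‖²`, the factor is `(15 ‖p‖² + 4) / 8 ≤ 31/32`. Then `M ≤ δ + (31/32) M`,
  -- which is the source of the constant `32`.
  have hpB : |B p r| ≤ M * (31 / 32) := by
    refine (hmix 4 (by norm_num)).trans ?_
    have : ‖p‖ ^ 2 ≤ 1 / 4 := by nlinarith [norm_nonneg p]
    have h8 : (4 ^ 2 * ‖p‖ ^ 2 + ‖r‖ ^ 2) / 8 ≤ 31 / 32 := by linarith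
    calc _ = M * ((4 ^ 2 * ‖p‖ ^ 2 + ‖r‖ ^ 2) / 8) := by ring
      _ ≤ _ := by gcongr
  have hfin : M ≤ 32 * δ := by
    have h9 : M ≤ |B y y| + |B p r| := by
      rw [hM, show B x₀ x₀ = B y y + B p r by linarith]; exact abs_add_le _ _
    linarith [hδ y hy]
  exact (hMb x).trans (by gcongr)

/-! ### Exponential moments of the squared length -/

section Exponential

theorem lintegral_exp_mul_expMeasure {r s : ℝ} (hr : 0 < r) (hs : s < r) :
    ∫⁻ x, ENNReal.ofReal (Real.exp (s * x)) ∂(expMeasure r) = ENNReal.ofReal (r / (r - s)) := by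
  have hrs : 0 < r - s := sub_pos.2 hs
  have h1 : expMeasure r = volume.withDensity (exponentialPDF r) := rfl
  have hmeas : ∀ q, Measurable (exponentialPDF q) := fun q =>
    (measurable_exponentialPDFReal q).ennreal_ofReal
  rw [h1, lintegral_withDensity_eq_lintegral_mul _ (hmeas r) (by fun_prop)]
  -- Tilting the density of rate `r` by `exp (s x)` gives `r / (r - s)` times the density of rate `r
  -- - s`.
  have h2 : ∀ x, (exponentialPDF r * fun x => ENNReal.ofReal (Real.exp (s * x))) x =
      ENNReal.ofReal (r / (r - s)) * exponentialPDF (r - s) x := fun x => by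
    rw [Pi.mul_apply, exponentialPDF_eq, exponentialPDF_eq, ← ENNReal.ofReal_mul (by
      split_ifs <;> positivity), ← ENNReal.ofReal_mul (by positivity)]
    congr 1
    split_ifs
    · rw [mul_assoc, ← Real.exp_add, ← mul_assoc, div_mul_cancel₀ _ hrs.ne']
      ring_nf
    · simp
  rw [lintegral_congr h2, lintegral_const_mul _ (hmeas _), lintegral_exponentialPDF_eq_one hrs,
    mul_one]

theorem integrable_exp_mul_expMeasure {r s : ℝ} (hr : 0 < r) (hs : s < r) :
    Integrable (fun x => Real.exp (s * x)) (expMeasure r) := by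
  refine ⟨by fun_prop, ?_⟩
  rw [hasFiniteIntegral_iff_ofReal (ae_of_all _ fun x => (Real.exp_pos _).le),
    lintegral_exp_mul_expMeasure hr hs]
  exact ENNReal.ofReal_lt_top

theorem integral_exp_mul_expMeasure {r s : ℝ} (hr : 0 < r) (hs : s < r) :
    ∫ x, Real.exp (s * x) ∂(expMeasure r) = r / (r - s) := by
  rw [integral_eq_lintegral_of_nonneg_ae (ae_of_all _ fun x => (Real.exp_pos _).le) (by fun_prop),
    lintegral_exp_mul_expMeasure hr hs,
    ENNReal.toReal_ofReal (div_nonneg hr.le (sub_pos.2 hs).le)]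

theorem ae_nonneg_expMeasure (r : ℝ) : ∀ᵐ x ∂(expMeasure r), 0 ≤ x := by
  have h1 : expMeasure r = volume.withDensity (exponentialPDF r) := rfl
  have hmeas : Measurable (exponentialPDF r) := (measurable_exponentialPDFReal r).ennreal_ofReal
  rw [h1, ae_withDensity_iff hmeas]
  refine ae_of_all _ fun x hx => ?_
  by_contra! h
  exact hx (exponentialPDF_of_neg h)

end Exponential

/-! ### Second moments of the angle -/

section UniformAngle

variable {α : ℝ}

theorem isProbabilityMeasure_cond_Icc (hα : 0 < α) :
    IsProbabilityMeasure (cond (volume : Measure ℝ) (Set.Icc 0 α)) :=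
  cond_isProbabilityMeasure_of_finite (by simp [hα]) (by simp)

theorem ae_mem_Icc_cond (α : ℝ) : ∀ᵐ b ∂(cond (volume : Measure ℝ) (Set.Icc 0 α)),
    b ∈ Set.Icc 0 α := by
  rw [ProbabilityTheory.cond]
  exact Measure.ae_smul_measure (ae_restrict_mem measurableSet_Icc) _

theorem integral_cond_Icc (hα : 0 < α) (h : ℝ → ℝ) :
    ∫ b, h b ∂(cond (volume : Measure ℝ) (Set.Icc 0 α)) = (∫ b in (0 : ℝ)..α, h b) / α := by
  rw [ProbabilityTheory.cond, integral_smul_measure, integral_Icc_eq_integral_Ioc,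
    ← intervalIntegral.integral_of_le hα.le]
  simp [ENNReal.toReal_ofReal hα.le, div_eq_inv_mul]

theorem integral_cos_sq_cond_Icc (hα : 0 < α) :
    ∫ b, Real.cos b ^ 2 ∂(cond (volume : Measure ℝ) (Set.Icc 0 α)) = ConeNMF.gAngle α := by
  rw [integral_cond_Icc hα, integral_cos_sq, ConeNMF.gAngle, Real.sin_two_mul]
  simp only [Real.sin_zero, mul_zero]
  field_simp
  ring

theorem integral_sin_sq_cond_Icc (hα : 0 < α) :
    ∫ b, Real.sin b ^ 2 ∂(cond (volume : Measure ℝ) (Set.Icc 0 α)) = ConeNMF.fAngle α := by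
  rw [integral_cond_Icc hα, integral_sin_sq, ConeNMF.fAngle, Real.sin_two_mul]
  simp only [Real.sin_zero, zero_mul]
  field_simp
  ring

end UniformAngle

/-! ### Second moments of the uniform law on a sphere -/

namespace ConeNMF

section Sphere

variable {E : Type*} [NormedAddCommGroup E] [InnerProductSpace ℝ E] [FiniteDimensional ℝ E]
  [MeasurableSpace E] [BorelSpace E]

theorem isProbabilityMeasure_uniformOnSphere [Nontrivial E] :
    IsProbabilityMeasure (uniformOnSphere E) := by
  have h0 : (volume : Measure E).toSphere Set.univ ≠ 0 := by
    rw [Ne, Measure.measure_univ_eq_zero]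
    exact Measure.toSphere_ne_zero _
  have : IsProbabilityMeasure
      (((volume : Measure E).toSphere Set.univ)⁻¹ • (volume : Measure E).toSphere) :=
    ⟨by rw [Measure.smul_apply, smul_eq_mul, ENNReal.inv_mul_cancel h0 (measure_ne_top _ _)]⟩
  exact Measure.isProbabilityMeasure_map measurable_subtype_coe.aemeasurable

theorem ae_norm_eq_one_uniformOnSphere : ∀ᵐ y ∂(uniformOnSphere E), ‖y‖ = 1 := by
  rw [uniformOnSphere, ae_map_iff measurable_subtype_coe.aemeasurable
    (measurableSet_eq_fun measurable_norm measurable_const)]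
  exact ae_of_all _ fun y => by simp

/-- Surface measure of a set is proportional to the volume of the solid sector over it, and linear
isometries preserve volume. -/
theorem map_uniformOnSphere (R : E ≃ₗᵢ[ℝ] E) :
    (uniformOnSphere E).map R = uniformOnSphere E := by
  have hR : Measurable R := R.continuous.measurable
  ext s hs
  rw [Measure.map_apply hR hs, uniformOnSphere,
    Measure.map_apply measurable_subtype_coe hs,
    Measure.map_apply measurable_subtype_coe (hR hs), Measure.smul_apply, Measure.smul_apply,
    Measure.toSphere_apply' _ (measurable_subtype_coe hs),
    Measure.toSphere_apply' _ (measurable_subtype_coe (hR hs))]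
  congr 2
  refine Eq.trans (congrArg _ ?_)
    (R.measurePreserving.measure_preimage_equiv (f := R.toMeasurableEquiv) _)
  ext y
  simp only [Set.mem_smul, Set.mem_image, Set.mem_preimage, Subtype.exists, mem_sphere_zero_iff_norm]
  constructor
  · rintro ⟨a, ha, _, ⟨z, hz, hzs, rfl⟩, rfl⟩
    exact ⟨a, ha, R z, ⟨R z, by simpa using hz, hzs, rfl⟩, by simp⟩
  · rintro ⟨a, ha, _, ⟨z, hz, hzs, rfl⟩, h⟩
    refine ⟨a, ha, R.symm z, ⟨R.symm z, by simpa using hz, by simpa using hzs, rfl⟩, ?_⟩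
    apply R.injective
    simpa using h

theorem integral_comp_uniformOnSphere (R : E ≃ₗᵢ[ℝ] E) {h : E → ℝ} (hh : Continuous h) :
    ∫ y, h (R y) ∂(uniformOnSphere E) = ∫ y, h y ∂(uniformOnSphere E) := by
  conv_rhs => rw [← map_uniformOnSphere R]
  rw [integral_map R.continuous.measurable.aemeasurable hh.aestronglyMeasurable]

theorem integrable_uniformOnSphere [Nontrivial E] {h : E → ℝ} (hh : Continuous h) :
    Integrable h (uniformOnSphere E) := by
  have := isProbabilityMeasure_uniformOnSphere (E := E)
  obtain ⟨C, hC⟩ := (isCompact_sphere (0 : E) 1).exists_bound_of_continuousOn hh.continuousOn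
  refine Integrable.of_bound hh.aestronglyMeasurable C ?_
  filter_upwards [ae_norm_eq_one_uniformOnSphere (E := E)] with y hy
  exact hC y (by simpa using hy)

theorem integral_inner_uniformOnSphere (x : E) : ∫ y, ⟪y, x⟫_ℝ ∂(uniformOnSphere E) = 0 := by
  have h := integral_comp_uniformOnSphere (LinearIsometryEquiv.neg ℝ)
    (h := fun y : E => ⟪y, x⟫_ℝ) (by fun_prop)
  simp only [LinearIsometryEquiv.coe_neg, inner_neg_left, integral_neg] at h
  linarith

/-- By reflection invariance the integral depends only on `‖x‖`; summed over an orthonormal basis it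
is the integral of `‖y‖² = 1`. -/
theorem integral_inner_sq_uniformOnSphere [Nontrivial E] (x : E) :
    ∫ y, ⟪y, x⟫_ℝ ^ 2 ∂(uniformOnSphere E) = ‖x‖ ^ 2 / Module.finrank ℝ E := by
  have hprob := isProbabilityMeasure_uniformOnSphere (E := E)
  have hrot : ∀ v w : E, ‖v‖ = ‖w‖ → ∫ y, ⟪y, v⟫_ℝ ^ 2 ∂(uniformOnSphere E) =
      ∫ y, ⟪y, w⟫_ℝ ^ 2 ∂(uniformOnSphere E) := fun v w hvw => by
    set R := (ℝ ∙ (v - w))ᗮ.reflection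
    rw [← integral_comp_uniformOnSphere R (h := fun y => ⟪y, w⟫_ℝ ^ 2) (by fun_prop)]
    have hRv : R v = w := Submodule.reflection_sub hvw
    refine integral_congr_ae (ae_of_all _ fun y => ?_)
    simp only
    rw [← hRv, R.inner_map_map]
  set b := stdOrthonormalBasis ℝ E
  have hsum : ∑ i, ∫ y, ⟪y, b i⟫_ℝ ^ 2 ∂(uniformOnSphere E) = 1 := by
    rw [← integral_finsetSum _ fun i _ => integrable_uniformOnSphere (by fun_prop)]
    rw [integral_congr_ae (g := fun _ => (1 : ℝ))]
    · simp
    · filter_upwards [ae_norm_eq_one_uniformOnSphere (E := E)] with y hy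
      simp_rw [b.sum_sq_inner_left, hy, one_pow]
  have hscale : ∀ i, ∫ y, ⟪y, x⟫_ℝ ^ 2 ∂(uniformOnSphere E) =
      ‖x‖ ^ 2 * ∫ y, ⟪y, b i⟫_ℝ ^ 2 ∂(uniformOnSphere E) := fun i => by
    rw [hrot x (‖x‖ • b i) (by simp [norm_smul]), ← integral_const_mul]
    simp_rw [inner_smul_right, mul_pow]
  have hpos : (0 : ℝ) < Module.finrank ℝ E := by exact_mod_cast Module.finrank_pos
  rw [eq_div_iff hpos.ne']
  calc (∫ y, ⟪y, x⟫_ℝ ^ 2 ∂(uniformOnSphere E)) * Module.finrank ℝ E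
      = ∑ _i : Fin (Module.finrank ℝ E), ∫ y, ⟪y, x⟫_ℝ ^ 2 ∂(uniformOnSphere E) := by
        simp [mul_comm]
    _ = ∑ i, ‖x‖ ^ 2 * ∫ y, ⟪y, b i⟫_ℝ ^ 2 ∂(uniformOnSphere E) :=
        Finset.sum_congr rfl fun i _ => hscale i
    _ = ‖x‖ ^ 2 := by rw [← Finset.mul_sum, hsum, mul_one]

end Sphere

end ConeNMF

/-! ### One cone: directions and moment generating function -/

namespace ConeNMF

variable {F : ℕ} {u : EuclideanSpace ℝ (Fin F)} {α lam : ℝ}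

theorem continuous_coneDirection (u : EuclideanSpace ℝ (Fin F)) :
    Continuous fun p : ℝ × (ℝ ∙ u)ᗮ =>
      Real.cos p.1 • u + Real.sin p.1 • (p.2 : EuclideanSpace ℝ (Fin F)) := by
  fun_prop

theorem finrank_orthogonal_of_norm_eq_one (hu : ‖u‖ = 1) :
    Module.finrank ℝ (ℝ ∙ u)ᗮ + 1 = F := by
  have h := (ℝ ∙ u).finrank_add_finrank_orthogonal
  rw [finrank_span_singleton (by rintro rfl; simp at hu), finrank_euclideanSpace_fin] at h
  omega

theorem nontrivial_orthogonal_of_norm_eq_one (hu : ‖u‖ = 1) (hF : 2 ≤ F) :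
    Nontrivial (ℝ ∙ u)ᗮ := by
  have h := finrank_orthogonal_of_norm_eq_one hu
  exact Module.nontrivial_of_finrank_pos (R := ℝ) (by omega)

theorem isProbabilityMeasure_coneDirectionLaw (hu : ‖u‖ = 1) (hF : 2 ≤ F) (hα : 0 < α) :
    IsProbabilityMeasure (coneDirectionLaw u α) := by
  have := nontrivial_orthogonal_of_norm_eq_one hu hF
  have := isProbabilityMeasure_uniformOnSphere (E := (ℝ ∙ u)ᗮ)
  have := isProbabilityMeasure_cond_Icc hα
  exact Measure.isProbabilityMeasure_map (continuous_coneDirection u).measurable.aemeasurable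

/-- Almost every direction is a unit vector of the cone. -/
theorem ae_coneDirectionLaw (hu : ‖u‖ = 1) (hF : 2 ≤ F) (hα : 0 < α) (hα' : α ≤ Real.pi) :
    ∀ᵐ z ∂(coneDirectionLaw u α), ‖z‖ = 1 ∧ Real.cos α ≤ ⟪z, u⟫_ℝ := by
  have := nontrivial_orthogonal_of_norm_eq_one hu hF
  have := isProbabilityMeasure_uniformOnSphere (E := (ℝ ∙ u)ᗮ)
  have := isProbabilityMeasure_cond_Icc hα
  rw [coneDirectionLaw, ae_map_iff (continuous_coneDirection u).measurable.aemeasurable]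
  · have h1 : ∀ᵐ p ∂((cond (volume : Measure ℝ) (Set.Icc 0 α)).prod (uniformOnSphere (ℝ ∙ u)ᗮ)),
        p.1 ∈ Set.Icc 0 α := Measure.quasiMeasurePreserving_fst.ae (ae_mem_Icc_cond α)
    have h2 : ∀ᵐ p ∂((cond (volume : Measure ℝ) (Set.Icc 0 α)).prod (uniformOnSphere (ℝ ∙ u)ᗮ)),
        ‖p.2‖ = 1 := Measure.quasiMeasurePreserving_snd.ae ae_norm_eq_one_uniformOnSphere
    filter_upwards [h1, h2] with p hp1 hp2
    have horth : ⟪(p.2 : EuclideanSpace ℝ (Fin F)), u⟫_ℝ = 0 :=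
      Submodule.mem_orthogonal_singleton_iff_inner_left.1 p.2.2
    have horth' : ⟪u, (p.2 : EuclideanSpace ℝ (Fin F))⟫_ℝ = 0 := by rw [real_inner_comm, horth]
    constructor
    · rw [← sq_eq_sq₀ (norm_nonneg _) zero_le_one, ← real_inner_self_eq_norm_sq]
      have hp2' : ‖(p.2 : EuclideanSpace ℝ (Fin F))‖ = 1 := hp2
      simp only [inner_add_left, inner_add_right, real_inner_smul_left, real_inner_smul_right,
        horth, horth', real_inner_self_eq_norm_sq, norm_smul, hu, hp2', Real.norm_eq_abs, mul_one,
        sq_abs]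
      nlinarith [Real.sin_sq_add_cos_sq p.1]
    · simp only [inner_add_left, real_inner_smul_left, horth, real_inner_self_eq_norm_sq, hu]
      simpa using Real.cos_le_cos_of_nonneg_of_le_pi hp1.1 hα' hp1.2
  · exact (measurableSet_eq_fun measurable_norm measurable_const).inter
      (measurableSet_le measurable_const
        (g := fun z : EuclideanSpace ℝ (Fin F) => ⟪z, u⟫_ℝ) (by fun_prop))

theorem integral_add_add {Ω : Type*} [MeasurableSpace Ω] {μ : Measure Ω} {f g h : Ω → ℝ}
    (hf : Integrable f μ) (hg : Integrable g μ) (hh : Integrable h μ) :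
    ∫ ω, (f ω + g ω + h ω) ∂μ = ∫ ω, f ω ∂μ + ∫ ω, g ω ∂μ + ∫ ω, h ω ∂μ := by
  rw [integral_add (f := fun ω => f ω + g ω) (hf.add hg) hh, integral_add hf hg]

/-- Expand `⟪cos θ u + sin θ y, x⟫²`. The cross term vanishes since `y` is centered, and `y` sees
only the projection of `x` to the complement of `u`, of dimension `F - 1` and squared norm `1 - ⟪u,
x⟫²`. -/
theorem integral_inner_sq_coneDirectionLaw (hu : ‖u‖ = 1) (hF : 2 ≤ F) (hα : 0 < α)
    {x : EuclideanSpace ℝ (Fin F)} (hx : ‖x‖ = 1) :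
    ∫ z, ⟪z, x⟫_ℝ ^ 2 ∂(coneDirectionLaw u α) =
      gAngle α * ⟪u, x⟫_ℝ ^ 2 + fAngle α / ((F : ℝ) - 1) * (1 - ⟪u, x⟫_ℝ ^ 2) := by
  have := nontrivial_orthogonal_of_norm_eq_one hu hF
  have := isProbabilityMeasure_uniformOnSphere (E := (ℝ ∙ u)ᗮ)
  have := isProbabilityMeasure_cond_Icc hα
  have hdim : (Module.finrank ℝ (ℝ ∙ u)ᗮ : ℝ) = (F : ℝ) - 1 := by
    have := finrank_orthogonal_of_norm_eq_one hu
    rw [eq_sub_iff_add_eq]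
    exact_mod_cast this
  set p := ⟪u, x⟫_ℝ
  set w := (ℝ ∙ u)ᗮ.orthogonalProjectionOnto x with hw
  have hinner : ∀ y : (ℝ ∙ u)ᗮ, ⟪(y : EuclideanSpace ℝ (Fin F)), x⟫_ℝ = ⟪y, w⟫_ℝ := fun y => by
    rw [hw, Submodule.inner_orthogonalProjectionOnto_eq_of_mem_left]
  have hnorm : ‖w‖ ^ 2 = 1 - p ^ 2 := by
    have h1 := (ℝ ∙ u).norm_sq_eq_add_norm_sq_projection x
    rw [hx] at h1
    have h2 : ‖(ℝ ∙ u).orthogonalProjectionOnto x‖ ^ 2 = p ^ 2 := by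
      rw [← Submodule.norm_coe, Submodule.coe_orthogonalProjectionOnto_apply,
        Submodule.starProjection_unit_singleton ℝ hu, norm_smul, hu, mul_one, Real.norm_eq_abs,
        sq_abs]
    linarith
  have hint : ∀ h : ℝ → ℝ, Continuous h →
      Integrable h (cond (volume : Measure ℝ) (Set.Icc 0 α)) := fun h hh => by
    rw [ProbabilityTheory.cond]
    exact (hh.integrableOn_Icc).smul_measure (by simp [hα])
  rw [coneDirectionLaw, integral_map (continuous_coneDirection u).measurable.aemeasurable
    (by fun_prop)]
  have hexp : ∀ q : ℝ × (ℝ ∙ u)ᗮ,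
      ⟪Real.cos q.1 • u + Real.sin q.1 • (q.2 : EuclideanSpace ℝ (Fin F)), x⟫_ℝ ^ 2 =
      (Real.cos q.1 ^ 2 * p ^ 2) * 1 + (2 * p * (Real.cos q.1 * Real.sin q.1)) * ⟪q.2, w⟫_ℝ +
        Real.sin q.1 ^ 2 * ⟪q.2, w⟫_ℝ ^ 2 := fun q => by
    rw [inner_add_left, real_inner_smul_left, real_inner_smul_left, hinner]
    ring
  simp_rw [hexp]
  have hI1 := (hint (fun b => Real.cos b ^ 2 * p ^ 2) (by fun_prop)).mul_prod
    (integrable_uniformOnSphere (E := (ℝ ∙ u)ᗮ) (h := fun _ => 1) (by fun_prop))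
  have hI2 := (hint (fun b => 2 * p * (Real.cos b * Real.sin b)) (by fun_prop)).mul_prod
    (integrable_uniformOnSphere (E := (ℝ ∙ u)ᗮ) (h := fun y => ⟪y, w⟫_ℝ) (by fun_prop))
  have hI3 := (hint (fun b => Real.sin b ^ 2) (by fun_prop)).mul_prod
    (integrable_uniformOnSphere (E := (ℝ ∙ u)ᗮ) (h := fun y => ⟪y, w⟫_ℝ ^ 2) (by fun_prop))
  rw [integral_add_add hI1 hI2 hI3,
    integral_prod_mul (fun b => Real.cos b ^ 2 * p ^ 2) (fun _ => (1 : ℝ)),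
    integral_prod_mul (fun b => 2 * p * (Real.cos b * Real.sin b)) (fun y => ⟪y, w⟫_ℝ),
    integral_prod_mul (fun b => Real.sin b ^ 2) (fun y => ⟪y, w⟫_ℝ ^ 2),
    integral_inner_uniformOnSphere, integral_inner_sq_uniformOnSphere, integral_mul_const,
    integral_cos_sq_cond_Icc hα, integral_sin_sq_cond_Icc hα, hnorm, hdim]
  simp
  ring

/-- If the cone lies in the orthant, no clipping takes place. -/
theorem coneColumnLaw_eq_map (hu : ‖u‖ = 1) (hF : 2 ≤ F) (hα : 0 < α) (hα' : α ≤ Real.pi)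
    (hcone : circularCone u α ⊆ orthant F) (hlam : 0 < lam) :
    coneColumnLaw u α lam =
      ((expMeasure lam).prod (coneDirectionLaw u α)).map (fun p => √p.1 • p.2) := by
  have := isProbabilityMeasure_coneDirectionLaw hu hF hα
  have := isProbabilityMeasure_expMeasure hlam
  refine Measure.map_congr ?_
  have h : ∀ᵐ p ∂((expMeasure lam).prod (coneDirectionLaw u α)),
      ‖p.2‖ = 1 ∧ Real.cos α ≤ ⟪p.2, u⟫_ℝ :=
    Measure.quasiMeasurePreserving_snd.ae (ae_coneDirectionLaw hu hF hα hα')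
  filter_upwards [h] with p hp
  have hmem : p.2 ∈ orthant F := hcone ⟨by rintro h0; simp [h0] at hp, by simpa [hp.1] using hp.2⟩
  simp only [clipToOrthant, if_pos hmem]

/-- With `q = y / r` this is `1 / (1 - q) ≤ 1 + q + 2 q²`; multiplied out, the slack is `q² (1 - 2
q)`, nonnegative for `q ≤ 1/2`. -/
theorem div_sub_le_one_add {r y : ℝ} (hr : 0 < r) (hy : |y| ≤ r / 2) :
    r / (r - y) ≤ 1 + y / r + 2 * y ^ 2 / r ^ 2 := by
  obtain ⟨h1, h2⟩ := abs_le.1 hy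
  have hry : 0 < r - y := by linarith
  rw [div_le_iff₀ hry, ← sub_nonneg]
  have h3 : (1 + y / r + 2 * y ^ 2 / r ^ 2) * (r - y) - r = y ^ 2 * (r - 2 * y) / r ^ 2 := by
    field_simp
    ring
  rw [h3]
  exact div_nonneg (mul_nonneg (sq_nonneg _) (by linarith)) (sq_nonneg _)

section Mgf

variable (hu : ‖u‖ = 1) (hF : 2 ≤ F) (hα : 0 < α) (hα' : α ≤ Real.pi)
  (hcone : circularCone u α ⊆ orthant F) (hlam : 0 < lam)
  {x : EuclideanSpace ℝ (Fin F)} (hx : ‖x‖ = 1) {s : ℝ} (hs : |s| ≤ lam / 2)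

theorem inner_sq_le_one_of_norm_eq_one {E : Type*} [NormedAddCommGroup E] [InnerProductSpace ℝ E]
    {x z : E} (hz : ‖z‖ = 1) (hx : ‖x‖ = 1) : ⟪z, x⟫_ℝ ^ 2 ≤ 1 := by
  have := abs_real_inner_le_norm z x
  rw [hz, hx, one_mul] at this
  rw [← sq_abs]
  exact pow_le_one₀ (abs_nonneg _) this

include hu hF hα hα' hlam hx hs in
theorem integrable_exp_mul_inner_sq_prod :
    Integrable (fun p : ℝ × EuclideanSpace ℝ (Fin F) => Real.exp (s * ⟪√p.1 • p.2, x⟫_ℝ ^ 2))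
      ((expMeasure lam).prod (coneDirectionLaw u α)) := by
  have := isProbabilityMeasure_coneDirectionLaw hu hF hα
  have := isProbabilityMeasure_expMeasure hlam
  have hdom := (integrable_exp_mul_expMeasure hlam (half_lt_self hlam)).comp_fst
    (coneDirectionLaw u α)
  -- Unit directions have `⟪z, x⟫² ≤ 1`, so `exp (lam l / 2)` dominates.
  refine hdom.mono' (by fun_prop) ?_
  have h1 : ∀ᵐ p ∂((expMeasure lam).prod (coneDirectionLaw u α)),
      ‖p.2‖ = 1 ∧ Real.cos α ≤ ⟪p.2, u⟫_ℝ :=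
    Measure.quasiMeasurePreserving_snd.ae (ae_coneDirectionLaw hu hF hα hα')
  have h2 : ∀ᵐ p ∂((expMeasure lam).prod (coneDirectionLaw u α)), 0 ≤ p.1 :=
    Measure.quasiMeasurePreserving_fst.ae (ae_nonneg_expMeasure lam)
  filter_upwards [h1, h2] with p hp1 hp2
  rw [Real.norm_of_nonneg (Real.exp_pos _).le, Real.exp_le_exp, real_inner_smul_left, mul_pow,
    Real.sq_sqrt hp2]
  have h3 := inner_sq_le_one_of_norm_eq_one hp1.1 hx
  calc s * (p.1 * ⟪p.2, x⟫_ℝ ^ 2) ≤ lam / 2 * (p.1 * ⟪p.2, x⟫_ℝ ^ 2) := by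
        gcongr; exact (le_abs_self s).trans hs
    _ ≤ lam / 2 * (p.1 * 1) := by gcongr
    _ = _ := by ring

include hu hF hα hα' hcone hlam hx hs in
theorem integrable_exp_mul_inner_sq_coneColumnLaw :
    Integrable (fun v => Real.exp (s * ⟪v, x⟫_ℝ ^ 2)) (coneColumnLaw u α lam) := by
  rw [coneColumnLaw_eq_map hu hF hα hα' hcone hlam,
    integrable_map_measure (by fun_prop) (by fun_prop)]
  exact integrable_exp_mul_inner_sq_prod hu hF hα hα' hlam hx hs

include hu hF hα hα' hcone hlam hx hs in
-- Integrate over the length first: given `z`, the value is `lam / (lam - s W)` with `W = ⟪z, x⟫² ≤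
-- 1`. The linear term keeps the exact mean, while the quadratic term is bounded uniformly in the
-- direction, free of `F` and `α`.
theorem mgf_inner_sq_coneColumnLaw_le :
    mgf (fun v => ⟪v, x⟫_ℝ ^ 2) (coneColumnLaw u α lam) s ≤
      1 + s * ((gAngle α * ⟪u, x⟫_ℝ ^ 2 +
        fAngle α / ((F : ℝ) - 1) * (1 - ⟪u, x⟫_ℝ ^ 2)) / lam) + 2 * s ^ 2 / lam ^ 2 := by
  have := isProbabilityMeasure_coneDirectionLaw hu hF hα
  have := isProbabilityMeasure_expMeasure hlam
  have hint := integrable_exp_mul_inner_sq_prod hu hF hα hα' hlam hx hs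
  have hbdd : ∀ᵐ z ∂(coneDirectionLaw u α), ‖⟪z, x⟫_ℝ ^ 2‖ ≤ 1 := by
    filter_upwards [ae_coneDirectionLaw hu hF hα hα'] with z hz
    rw [Real.norm_of_nonneg (sq_nonneg _)]
    exact inner_sq_le_one_of_norm_eq_one hz.1 hx
  have hintz : Integrable (fun z => ⟪z, x⟫_ℝ ^ 2) (coneDirectionLaw u α) :=
    Integrable.of_bound (by fun_prop) 1 hbdd
  rw [mgf, coneColumnLaw_eq_map hu hF hα hα' hcone hlam,
    integral_map (by fun_prop) (by fun_prop), integral_prod_symm _ hint]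
  have hinner : ∀ᵐ z ∂(coneDirectionLaw u α),
      ∫ l, Real.exp (s * ⟪√l • z, x⟫_ℝ ^ 2) ∂(expMeasure lam) ≤
        1 + s / lam * ⟪z, x⟫_ℝ ^ 2 + 2 * s ^ 2 / lam ^ 2 := by
    filter_upwards [ae_coneDirectionLaw hu hF hα hα'] with z hz
    have hz1 := inner_sq_le_one_of_norm_eq_one hz.1 hx
    set W := ⟪z, x⟫_ℝ ^ 2 with hW
    have hW0 : 0 ≤ W := sq_nonneg _
    have hsW : |s * W| ≤ lam / 2 := by
      rw [abs_mul, abs_of_nonneg hW0]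
      exact (mul_le_of_le_one_right (abs_nonneg s) hz1).trans hs
    have hlt : s * W < lam := (le_abs_self _).trans_lt (hsW.trans_lt (half_lt_self hlam))
    have heq : ∫ l, Real.exp (s * ⟪√l • z, x⟫_ℝ ^ 2) ∂(expMeasure lam) =
        ∫ l, Real.exp (s * W * l) ∂(expMeasure lam) := by
      refine integral_congr_ae ?_
      filter_upwards [ae_nonneg_expMeasure lam] with l hl
      rw [real_inner_smul_left, mul_pow, Real.sq_sqrt hl, ← hW]
      congr 1; ring
    rw [heq, integral_exp_mul_expMeasure hlam hlt]
    refine (div_sub_le_one_add hlam hsW).trans ?_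
    have h4 : (s * W) ^ 2 ≤ s ^ 2 := by
      rw [mul_pow]
      exact mul_le_of_le_one_right (sq_nonneg s) (pow_le_one₀ hW0 hz1)
    rw [show s * W / lam = s / lam * W by ring]
    gcongr
  refine (integral_mono_ae hint.integral_prod_right ?_ hinner).trans ?_
  · exact ((integrable_const _).add (hintz.const_mul _)).add (integrable_const _)
  rw [integral_add_add (integrable_const _) (hintz.const_mul _) (integrable_const _),
    integral_const_mul,
    integral_inner_sq_coneDirectionLaw hu hF hα hx]
  simp only [integral_const, probReal_univ, one_smul]
  apply le_of_eq
  ring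

end Mgf

end ConeNMF

/-! ### Chernoff bound -/

/-- A Chernoff bound for sums of independent variables whose moment generating function is
subgaussian near `0`. -/
theorem measureReal_abs_sum_sub_ge_le {Ω : Type*} [MeasurableSpace Ω] {μ : Measure Ω}
    [IsProbabilityMeasure μ] {N : ℕ} {X : Fin N → Ω → ℝ} (hX : iIndepFun X μ)
    (hmeas : ∀ n, AEMeasurable (X n) μ) {m r η : ℝ} (hr : 0 < r) (hη : 0 ≤ η) (hηr : η * r ≤ 2)
    (hint : ∀ n s, |s| ≤ r / 2 → Integrable (fun ω => Real.exp (s * X n ω)) μ)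
    (hmgf : ∀ n s, |s| ≤ r / 2 → mgf (X n) μ s ≤ Real.exp (s * m + 2 * s ^ 2 / r ^ 2)) :
    μ.real {ω | N * η ≤ |∑ n, X n ω - N * m|} ≤ 2 * Real.exp (-(N * (η ^ 2 * r ^ 2 / 8))) := by
  -- The minimizer of `-s η + 2 s² / r²`, with minimum `-η² r² / 8`; `η r ≤ 2` keeps it in the range
  -- `|s| ≤ r / 2`.
  set s := η * r ^ 2 / 4 with hs
  have hs0 : 0 ≤ s := by positivity
  have hsr : |s| ≤ r / 2 := by rw [abs_of_nonneg hs0, hs]; nlinarith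
  have hsr' : |-s| ≤ r / 2 := by rwa [abs_neg]
  -- A non-integrable exponential would make the mgf `0` by convention, but by independence it is a
  -- product of positive factors.
  have hint' : ∀ q, |q| ≤ r / 2 →
      Integrable (fun ω => Real.exp (q * (∑ n, X n) ω)) μ := fun q hq => by
    by_contra h
    have h0 := mgf_undef h
    rw [hX.mgf_sum₀ hmeas] at h0
    exact (Finset.prod_pos fun n _ => mgf_pos (hint n q hq)).ne' h0
  have hmgf' : ∀ q, |q| ≤ r / 2 →
      mgf (∑ n, X n) μ q ≤ Real.exp (N * (q * m + 2 * q ^ 2 / r ^ 2)) := fun q hq => by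
    rw [hX.mgf_sum₀ hmeas]
    calc ∏ n, mgf (X n) μ q ≤ ∏ _n : Fin N, Real.exp (q * m + 2 * q ^ 2 / r ^ 2) :=
          Finset.prod_le_prod (fun n _ => mgf_nonneg) fun n _ => hmgf n q hq
      _ = _ := by rw [Finset.prod_const, Finset.card_univ, Fintype.card_fin, Real.exp_nat_mul]
  have hup : μ.real {ω | N * (m + η) ≤ (∑ n, X n) ω} ≤
      Real.exp (-(N * (η ^ 2 * r ^ 2 / 8))) := by
    refine (measure_ge_le_exp_mul_mgf _ hs0 (hint' s hsr)).trans ?_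
    refine (mul_le_mul_of_nonneg_left (hmgf' s hsr) (Real.exp_pos _).le).trans ?_
    rw [← Real.exp_add]
    apply le_of_eq
    congr 1
    rw [hs]; field_simp; ring
  have hlow : μ.real {ω | (∑ n, X n) ω ≤ N * (m - η)} ≤
      Real.exp (-(N * (η ^ 2 * r ^ 2 / 8))) := by
    refine (measure_le_le_exp_mul_mgf _ (neg_nonpos.2 hs0) (hint' (-s) hsr')).trans ?_
    refine (mul_le_mul_of_nonneg_left (hmgf' (-s) hsr') (Real.exp_pos _).le).trans ?_
    rw [← Real.exp_add]
    apply le_of_eq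
    congr 1
    rw [hs]; field_simp; ring
  have hsub : {ω | N * η ≤ |∑ n, X n ω - N * m|} ⊆
      {ω | N * (m + η) ≤ (∑ n, X n) ω} ∪ {ω | (∑ n, X n) ω ≤ N * (m - η)} := fun ω hω => by
    simp only [Set.mem_union, Set.mem_ofPred_eq, Finset.sum_apply] at hω ⊢
    rcases le_abs.1 hω with h | h
    · left; linarith
    · right; linarith
  calc _ ≤ μ.real ({ω | N * (m + η) ≤ (∑ n, X n) ω} ∪ {ω | (∑ n, X n) ω ≤ N * (m - η)}) :=
        measureReal_mono hsub
    _ ≤ _ := measureReal_union_le _ _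
    _ ≤ _ := by linarith

/-! ### Mixture of cones and uniform deviation -/

namespace ConeNMF

variable {F K : ℕ} {u : Fin K → EuclideanSpace ℝ (Fin F)} {α lam : ℝ}

/-- The quadratic form of the second moment matrix of a column. -/
noncomputable def secondMoment (u : Fin K → EuclideanSpace ℝ (Fin F)) (α lam : ℝ)
    (x : EuclideanSpace ℝ (Fin F)) : ℝ :=
  aCoef F α lam * ‖x‖ ^ 2 + bCoef F K α lam * ∑ k, ⟪u k, x⟫_ℝ ^ 2

section ColumnLaw

variable (hu : ∀ k, ‖u k‖ = 1) (hF : 2 ≤ F) (hα : 0 < α) (hα' : α ≤ Real.pi)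
  (hcone : ∀ k, circularCone (u k) α ⊆ orthant F) (hlam : 0 < lam) (hK : 0 < K)
  {x : EuclideanSpace ℝ (Fin F)} (hx : ‖x‖ = 1) {s : ℝ} (hs : |s| ≤ lam / 2)

include hu hF hα hα' hcone hlam hK hx hs

theorem integrable_exp_mul_inner_sq_columnLaw :
    Integrable (fun v => Real.exp (s * ⟪v, x⟫_ℝ ^ 2))
      (columnLaw u (fun _ => α) (fun _ => lam)) := by
  rw [columnLaw]
  refine Integrable.smul_measure ?_ (by simpa using hK.ne')
  rw [integrable_finsetSum_measure]
  exact fun k _ =>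
    integrable_exp_mul_inner_sq_coneColumnLaw (hu k) hF hα hα' (hcone k) hlam hx hs

/-- Averaging the single-cone bounds gives exactly `1 + s M(x) + 2 s² / lam²`, where `M` is
`secondMoment`: the `K` in the denominator of `bCoef` is the mixture weight. Then `1 + y ≤ exp y`.
-/
theorem mgf_inner_sq_columnLaw_le :
    mgf (fun v => ⟪v, x⟫_ℝ ^ 2) (columnLaw u (fun _ => α) (fun _ => lam)) s ≤
      Real.exp (s * secondMoment u α lam x + 2 * s ^ 2 / lam ^ 2) := by
  have hK' : (0 : ℝ) < K := by exact_mod_cast hK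
  rw [mgf, columnLaw, integral_smul_measure, integral_finsetSum_measure fun k _ =>
    integrable_exp_mul_inner_sq_coneColumnLaw (hu k) hF hα hα' (hcone k) hlam hx hs]
  have h1 := Finset.sum_le_sum fun k (_ : k ∈ Finset.univ) =>
    mgf_inner_sq_coneColumnLaw_le (hu k) hF hα hα' (hcone k) hlam hx hs
  refine le_trans ?_ (Real.add_one_le_exp _)
  rw [ENNReal.toReal_inv, ENNReal.toReal_natCast, smul_eq_mul, inv_mul_le_iff₀ hK']
  refine h1.trans (le_of_eq ?_)
  have hF' : (F : ℝ) - 1 ≠ 0 := by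
    have : (2 : ℝ) ≤ F := by exact_mod_cast hF
    linarith
  have h2 : ∀ k, 1 + s * ((gAngle α * ⟪u k, x⟫_ℝ ^ 2 +
      fAngle α / ((F : ℝ) - 1) * (1 - ⟪u k, x⟫_ℝ ^ 2)) / lam) + 2 * s ^ 2 / lam ^ 2 =
      (1 + s * aCoef F α lam + 2 * s ^ 2 / lam ^ 2) +
        K * s * bCoef F K α lam * ⟪u k, x⟫_ℝ ^ 2 := fun k => by
    rw [aCoef, bCoef]
    field_simp
    ring
  rw [Finset.sum_congr rfl fun k _ => h2 k, Finset.sum_add_distrib, ← Finset.mul_sum,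
    secondMoment, hx]
  simp only [Finset.sum_const, Finset.card_univ, Fintype.card_fin, nsmul_eq_mul]
  ring

end ColumnLaw

/-- The bridge between singular values of the matrix and sums over independent columns. -/
theorem norm_adjoint_toEuclideanLin_dataMatrix_sq {N : ℕ} (v : Fin N → EuclideanSpace ℝ (Fin F))
    (x : EuclideanSpace ℝ (Fin F)) :
    ‖LinearMap.adjoint (Matrix.toEuclideanLin (dataMatrix v)) x‖ ^ 2 = ∑ n, ⟪v n, x⟫_ℝ ^ 2 := by
  rw [← (EuclideanSpace.basisFun (Fin N) ℝ).sum_sq_inner_right]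
  refine Finset.sum_congr rfl fun n _ => ?_
  rw [LinearMap.adjoint_inner_right]
  congr 2
  ext i
  simp [Matrix.toLpLin_apply, dataMatrix]

theorem lt_rank_iff_singularValues_pos {N : ℕ} (V : Matrix (Fin F) (Fin N) ℝ) (j : ℕ) :
    j < V.rank ↔ 0 < (Matrix.toEuclideanLin V).singularValues j := by
  rw [LinearMap.singularValues_pos_iff_lt_finrank_range,
    V.rank_eq_finrank_range_toLin (EuclideanSpace.basisFun (Fin F) ℝ).toBasis
      (EuclideanSpace.basisFun (Fin N) ℝ).toBasis, Matrix.toEuclideanLin_eq_toLin_orthonormal]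

/-- If the sample second moments are `ε/32`-accurate on a `1/2`-net of the sphere, then they are
`ε`-accurate everywhere. -/
theorem abs_sum_inner_sq_sub_le {N : ℕ} (v : Fin N → EuclideanSpace ℝ (Fin F)) {ε : ℝ}
    (s : Set (EuclideanSpace ℝ (Fin F))) (hs : ∀ y ∈ s, ‖y‖ = 1)
    (hnet : ∀ x : EuclideanSpace ℝ (Fin F), ‖x‖ = 1 → ∃ y ∈ s, ‖x - y‖ < 1 / 2)
    (h : ∀ y ∈ s, |∑ n, ⟪v n, y⟫_ℝ ^ 2 - N * secondMoment u α lam y| ≤ N * (ε / 32))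
    (x : EuclideanSpace ℝ (Fin F)) :
    |∑ n, ⟪v n, x⟫_ℝ ^ 2 - N * secondMoment u α lam x| ≤ N * ε * ‖x‖ ^ 2 := by
  let T := LinearMap.adjoint (Matrix.toEuclideanLin (dataMatrix v))
  let U := LinearMap.adjoint (Matrix.toEuclideanLin (dataMatrix u))
  -- The polarization of the deviation; `U` encodes `∑ ⟪u k, x⟫²` just as `T` encodes the sample
  -- sum.
  let B : EuclideanSpace ℝ (Fin F) →ₗ[ℝ] EuclideanSpace ℝ (Fin F) →ₗ[ℝ] ℝ :=
    (innerₗ _).compl₁₂ T T - (N * aCoef F α lam) • innerₗ _ -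
      (N * bCoef F K α lam) • (innerₗ _).compl₁₂ U U
  have hBapp : ∀ x y, B x y = ⟪T x, T y⟫_ℝ - N * aCoef F α lam * ⟪x, y⟫_ℝ -
      N * bCoef F K α lam * ⟪U x, U y⟫_ℝ := fun x y => rfl
  have hB : ∀ x, B x x = ∑ n, ⟪v n, x⟫_ℝ ^ 2 - N * secondMoment u α lam x := fun x => by
    rw [hBapp, real_inner_self_eq_norm_sq, real_inner_self_eq_norm_sq, real_inner_self_eq_norm_sq,
      norm_adjoint_toEuclideanLin_dataMatrix_sq, norm_adjoint_toEuclideanLin_dataMatrix_sq,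
      secondMoment]
    ring
  have := abs_bilin_self_le_of_half_net B
    (fun x y => by rw [hBapp, hBapp, real_inner_comm (T x), real_inner_comm x,
      real_inner_comm (U x)]) s hs hnet
    (fun y hy => by rw [hB]; exact h y hy) x
  rw [hB] at this
  linarith

/-- With high probability the sample second moments are uniformly `ε`-accurate. -/
theorem one_sub_le_measureReal_forall_abs_sum_inner_sq_sub_le {Ω : Type*} [MeasurableSpace Ω]
    {μ : Measure Ω} [IsProbabilityMeasure μ] {N : ℕ} {v : Fin N → Ω → EuclideanSpace ℝ (Fin F)}
    (hu : ∀ k, ‖u k‖ = 1) (hF : 2 ≤ F) (hα : 0 < α) (hα' : α ≤ Real.pi)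
    (hcone : ∀ k, circularCone (u k) α ⊆ orthant F) (hlam : 0 < lam) (hK : 0 < K)
    (hv : IsGenerated μ u (fun _ => α) (fun _ => lam) v) {t ε : ℝ} (ht : 1 ≤ t) (hε : 0 < ε)
    (hεlam : ε * lam ≤ 1) (hN : 24576 / lam ^ 2 * (t / ε) ^ 2 * F ≤ N) :
    1 - 2 * Real.exp (-(t ^ 2 * F)) ≤ μ.real {ω | ∀ x : EuclideanSpace ℝ (Fin F),
      |∑ n, ⟪v n ω, x⟫_ℝ ^ 2 - N * secondMoment u α lam x| ≤ N * ε * ‖x‖ ^ 2} := by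
  obtain ⟨net, hcard, hsphere, hnet⟩ := exists_half_net_sphere (EuclideanSpace ℝ (Fin F))
  rw [finrank_euclideanSpace_fin] at hcard
  set bad : EuclideanSpace ℝ (Fin F) → Set Ω := fun y =>
    {ω | N * (ε / 32) ≤ |∑ n, ⟪v n ω, y⟫_ℝ ^ 2 - N * secondMoment u α lam y|} with hbad
  set good : Set Ω := {ω | ∀ x : EuclideanSpace ℝ (Fin F),
      |∑ n, ⟪v n ω, x⟫_ℝ ^ 2 - N * secondMoment u α lam x| ≤ N * ε * ‖x‖ ^ 2} with hgood
  have hbadle : ∀ y ∈ net, μ.real (bad y) ≤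
      2 * Real.exp (-(N * ((ε / 32) ^ 2 * lam ^ 2 / 8))) := fun y hy => by
    have hae : ∀ n, AEMeasurable (v n) μ := fun n => (hv.hasLaw n).aemeasurable
    refine measureReal_abs_sum_sub_ge_le (X := fun n ω => ⟪v n ω, y⟫_ℝ ^ 2)
      (hv.indep.comp (fun _ w => ⟪w, y⟫_ℝ ^ 2) fun _ => by fun_prop)
      (fun n => (by fun_prop : Measurable fun w : EuclideanSpace ℝ (Fin F) =>
        ⟪w, y⟫_ℝ ^ 2).comp_aemeasurable (hae n))
      hlam (by positivity) (by linarith) (fun n s hs => ?_) fun n s hs => ?_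
    · have h1 := integrable_exp_mul_inner_sq_columnLaw hu hF hα hα' hcone hlam hK
        (hsphere y hy) hs
      rw [← (hv.hasLaw n).map_eq] at h1
      exact (integrable_map_measure (by fun_prop) (hae n)).1 h1
    · have h1 := mgf_inner_sq_columnLaw_le hu hF hα hα' hcone hlam hK (hsphere y hy) hs
      rw [← (hv.hasLaw n).map_eq, mgf_map (hae n) (by fun_prop)] at h1
      exact h1
  -- A covering and subadditivity suffice, so the measurability of `good` plays no role.
  have hcover : Set.univ ⊆ good ∪ ⋃ y ∈ net, bad y := fun ω _ => by
    by_cases h : ∃ y ∈ net, ω ∈ bad y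
    · obtain ⟨y, hy, hω⟩ := h
      exact Or.inr (Set.mem_biUnion hy hω)
    · left
      push Not at h
      refine abs_sum_inner_sq_sub_le (fun n => v n ω) (net : Set (EuclideanSpace ℝ (Fin F)))
        hsphere hnet fun y hy => ?_
      exact (not_le.1 (h y hy)).le
  have h1 : 1 ≤ μ.real good + ∑ y ∈ net, μ.real (bad y) := by
    calc (1 : ℝ) = μ.real Set.univ := probReal_univ.symm
      _ ≤ μ.real (good ∪ ⋃ y ∈ net, bad y) := measureReal_mono hcover
      _ ≤ μ.real good + μ.real (⋃ y ∈ net, bad y) := measureReal_union_le _ _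
      _ ≤ _ := by gcongr; exact measureReal_biUnion_finset_le _ _
  have h2 : ∑ y ∈ net, μ.real (bad y) ≤ 2 * Real.exp (-(t ^ 2 * F)) := by
    -- Here `24576 = 3 · 8 · 32²`: `8` from Chernoff, `32²` from the net accuracy `ε/32`. Of the
    -- three copies of `t² F`, two absorb the `5 ^ F` net points and one remains.
    have hexpo : 3 * (t ^ 2 * F) ≤ N * ((ε / 32) ^ 2 * lam ^ 2 / 8) := by
      calc 3 * (t ^ 2 * F) = 24576 / lam ^ 2 * (t / ε) ^ 2 * F * ((ε / 32) ^ 2 * lam ^ 2 / 8) := by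
            field_simp; norm_num
        _ ≤ _ := by gcongr
    have hfive : (5 : ℝ) ^ F ≤ Real.exp (2 * (t ^ 2 * F)) := by
      have h5 : (5 : ℝ) ≤ Real.exp 2 := by
        have := Real.exp_one_gt_d9
        rw [show (2 : ℝ) = 1 + 1 by norm_num, Real.exp_add]
        nlinarith
      calc (5 : ℝ) ^ F ≤ Real.exp 2 ^ F := by gcongr
        _ = Real.exp (F * 2) := (Real.exp_nat_mul _ _).symm
        _ ≤ _ := by
          rw [Real.exp_le_exp]
          have : (1 : ℝ) ≤ t ^ 2 := one_le_pow₀ ht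
          nlinarith [(Nat.cast_nonneg F : (0 : ℝ) ≤ F)]
    have hcard' : (net.card : ℝ) ≤ 5 ^ F := by exact_mod_cast hcard
    calc ∑ y ∈ net, μ.real (bad y)
        ≤ ∑ _y ∈ net, 2 * Real.exp (-(N * ((ε / 32) ^ 2 * lam ^ 2 / 8))) :=
          Finset.sum_le_sum hbadle
      _ = net.card * (2 * Real.exp (-(N * ((ε / 32) ^ 2 * lam ^ 2 / 8)))) := by
          rw [Finset.sum_const, nsmul_eq_mul]
      _ ≤ Real.exp (2 * (t ^ 2 * F)) * (2 * Real.exp (-(3 * (t ^ 2 * F)))) := by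
          gcongr; exact hcard'.trans hfive
      _ = 2 * (Real.exp (2 * (t ^ 2 * F)) * Real.exp (-(3 * (t ^ 2 * F)))) := by ring
      _ = 2 * Real.exp (-(t ^ 2 * F)) := by
          rw [← Real.exp_add]; ring_nf
  linarith

/-! ### Equiangular unit vectors -/

section Equiangular

variable {E : Type*} [NormedAddCommGroup E] [InnerProductSpace ℝ E] {w : Fin K → E} {γ : ℝ}
  (hw : ∀ k, ‖w k‖ = 1) (hγ : ∀ i j, i ≠ j → ⟪w i, w j⟫_ℝ = γ)

include hw hγ

theorem inner_sum_smul_of_equiangular (c : Fin K → ℝ) (k : Fin K) :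
    ⟪w k, ∑ i, c i • w i⟫_ℝ = (1 - γ) * c k + γ * ∑ i, c i := by
  have h1 : ∀ i, ⟪w k, c i • w i⟫_ℝ = γ * c i + if i = k then (1 - γ) * c k else 0 := fun i => by
    rw [real_inner_smul_right]
    split_ifs with h
    · subst h; rw [real_inner_self_eq_norm_sq, hw]; ring
    · rw [hγ k i (Ne.symm h)]; ring
  rw [inner_sum, Finset.sum_congr rfl fun i _ => h1 i, Finset.sum_add_distrib, ← Finset.mul_sum]
  simp [add_comm]

theorem norm_sum_smul_sq_of_equiangular (c : Fin K → ℝ) :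
    ‖∑ i, c i • w i‖ ^ 2 = (1 - γ) * ∑ i, c i ^ 2 + γ * (∑ i, c i) ^ 2 := by
  rw [← real_inner_self_eq_norm_sq, sum_inner]
  simp_rw [real_inner_smul_left, inner_sum_smul_of_equiangular hw hγ]
  simp_rw [mul_add, Finset.sum_add_distrib, Finset.mul_sum, sq, Finset.sum_mul, Finset.mul_sum]
  congr 1
  · exact Finset.sum_congr rfl fun i _ => by ring
  · exact Finset.sum_congr rfl fun i _ => Finset.sum_congr rfl fun j _ => by ring

theorem linearIndependent_of_equiangular (h0 : 0 ≤ γ) (h1 : γ < 1) : LinearIndependent ℝ w := by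
  rw [Fintype.linearIndependent_iff]
  intro c hc k
  have h2 := norm_sum_smul_sq_of_equiangular hw hγ c
  rw [hc, norm_zero] at h2
  have h3 : c k ^ 2 ≤ ∑ i, c i ^ 2 :=
    Finset.single_le_sum (fun i _ => sq_nonneg (c i)) (Finset.mem_univ k)
  have h4 : 0 ≤ γ * (∑ i, c i) ^ 2 := by positivity
  have h5 : (1 - γ) * c k ^ 2 ≤ (1 - γ) * ∑ i, c i ^ 2 :=
    mul_le_mul_of_nonneg_left h3 (by linarith)
  have h6 : c k ^ 2 ≤ 0 := by
    by_contra! h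
    nlinarith [mul_pos (sub_pos.2 h1) h]
  exact pow_eq_zero_iff two_ne_zero |>.1 (le_antisymm h6 (sq_nonneg _))

/-- For `x = ∑ c i • w i` and Gram matrix `G = (1 - γ) I + γ J`, this says `(1 - γ) cᵀ G c ≤ ‖G
c‖²`, true since `G` has no eigenvalue below `1 - γ` when `γ ≥ 0`. -/
theorem le_sum_inner_sq_of_mem_span (h0 : 0 ≤ γ) (h1 : γ ≤ 1) {x : E}
    (hx : x ∈ Submodule.span ℝ (Set.range w)) :
    (1 - γ) * ‖x‖ ^ 2 ≤ ∑ k, ⟪w k, x⟫_ℝ ^ 2 := by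
  obtain ⟨c, rfl⟩ := (Submodule.mem_span_range_iff_exists_fun ℝ).1 hx
  rw [norm_sum_smul_sq_of_equiangular hw hγ]
  simp_rw [inner_sum_smul_of_equiangular hw hγ]
  set S := ∑ i, c i with hS
  have h2 : ∀ k, ((1 - γ) * c k + γ * S) ^ 2 =
      (1 - γ) ^ 2 * c k ^ 2 + 2 * (1 - γ) * γ * S * c k + (γ * S) ^ 2 := fun k => by ring
  simp_rw [h2, Finset.sum_add_distrib, ← Finset.mul_sum, ← hS]
  have h3 : 0 ≤ ∑ _k : Fin K, (γ * S) ^ 2 := Finset.sum_nonneg fun _ _ => sq_nonneg _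
  have h4 : 0 ≤ (1 - γ) * γ * S ^ 2 := by have := sub_nonneg.2 h1; positivity
  nlinarith

/-- The coefficients `p k = ⟪w k, x⟫` sum to zero, so `J` kills them and `‖∑ p k • w k‖² = (1 - γ)
Q`. Cauchy–Schwarz on `Q = ⟪∑ p k • w k, x⟫` finishes. One linear condition thus removes the top
eigenvalue. -/
theorem sum_inner_sq_le_of_inner_sum_eq_zero (h1 : γ ≤ 1) {x : E} (hx : ⟪∑ k, w k, x⟫_ℝ = 0) :
    ∑ k, ⟪w k, x⟫_ℝ ^ 2 ≤ (1 - γ) * ‖x‖ ^ 2 := by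
  set p : Fin K → ℝ := fun k => ⟪w k, x⟫_ℝ with hp
  have hsum : ∑ k, p k = 0 := by rw [← hx, sum_inner]
  have hnorm := norm_sum_smul_sq_of_equiangular hw hγ p
  rw [hsum] at hnorm
  set Q := ∑ k, p k ^ 2 with hQ
  have h2 : Q = ⟪∑ k, p k • w k, x⟫_ℝ := by
    rw [sum_inner, hQ]
    exact Finset.sum_congr rfl fun k _ => by rw [real_inner_smul_left, sq]
  have h3 : Q ^ 2 ≤ (‖∑ k, p k • w k‖ * ‖x‖) ^ 2 := by
    rw [sq_le_sq, abs_of_nonneg (by positivity : 0 ≤ ‖∑ k, p k • w k‖ * ‖x‖)]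
    nth_rw 1 [h2]
    exact abs_real_inner_le_norm _ _
  rw [mul_pow, hnorm] at h3
  have hQ0 : 0 ≤ Q := Finset.sum_nonneg fun _ _ => sq_nonneg _
  rcases hQ0.eq_or_lt with h4 | h4
  · have := sub_nonneg.2 h1
    rw [← h4]; positivity
  · nlinarith

end Equiangular

end ConeNMF

/-! ### Location of the largest ratio -/

namespace ConeNMF

/-- Since `ε < a`, this puts `ε lam` in the range where the Chernoff bound applies. -/
theorem aCoef_mul_le_half {F : ℕ} {α lam : ℝ} (hF : 2 ≤ F) (hα : 0 < α) (hα' : α < Real.pi / 2)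
    (hlam : 0 < lam) (ha : 0 < aCoef F α lam) : aCoef F α lam * lam ≤ 1 / 2 := by
  have hF' : (1 : ℝ) ≤ (F : ℝ) - 1 := by
    have : (2 : ℝ) ≤ F := by exact_mod_cast hF
    linarith
  have hf : fAngle α ≤ 1 / 2 := by
    have : 0 ≤ Real.sin (2 * α) / (4 * α) :=
      div_nonneg (Real.sin_nonneg_of_nonneg_of_le_pi (by linarith) (by linarith)) (by linarith)
    rw [fAngle]; linarith
  have h1 : aCoef F α lam * lam * ((F : ℝ) - 1) = fAngle α := by
    rw [aCoef]; field_simp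
  have h2 : 0 ≤ aCoef F α lam * lam := by positivity
  nlinarith

/-- A sequence that is nearly constant on `1 ≤ i < K` and on `K ≤ i ≤ Kmax` has its largest ratio of
consecutive terms at the jump between `K - 1` and `K`. -/
theorem div_succ_lt_of_bounds {σ : ℕ → ℝ} {K Kmin Kmax : ℕ} {L U L' U' : ℝ} (hL : 0 < L)
    (hL' : 0 < L') (hU : 0 ≤ U) (hgap : U / L < L' / U) (hgap' : U' / L' ≤ U / L)
    (hKmin : 1 < Kmin) (hKmax : K ≤ Kmax)
    (hlow : ∀ i ≤ Kmax, L ≤ σ i) (hup : ∀ i, K ≤ i → σ i ≤ U)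
    (hlow' : ∀ i < K, L' ≤ σ i) (hup' : ∀ i, 1 ≤ i → σ i ≤ U') {j : ℕ}
    (hj : j ∈ Set.Icc Kmin Kmax) (hjK : j ≠ K) (hKK : 0 < K) :
    σ (j - 1) / σ j < σ (K - 1) / σ K := by
  have hratio : L' / U ≤ σ (K - 1) / σ K :=
    div_le_div₀ (hL'.le.trans (hlow' _ (by omega))) (hlow' _ (by omega))
      (hL.trans_le (hlow K hKmax)) (hup K le_rfl)
  refine lt_of_lt_of_le (lt_of_le_of_lt ?_ hgap) hratio
  obtain ⟨hj1, hj2⟩ := hj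
  -- For `j < K` the index `j - 1` is at least `1` because `1 < Kmin`; the value at index `0` has no
  -- upper bound.
  rcases lt_or_gt_of_ne hjK with h | h
  · refine le_trans ?_ hgap'
    exact div_le_div₀ (hL'.le.trans ((hlow' j h).trans (hup' j (by omega)))) (hup' _ (by omega))
      hL' (hlow' j h)
  · exact div_le_div₀ hU (hup _ (by omega)) hL (hlow j hj2)

/-- Uniform accuracy of the sample second moments forces the singular value ratio to peak at `K`. -/
theorem ratioArgmax_eq_of_abs_sum_inner_sq_sub_le {F K N Kmin Kmax : ℕ}
    {u : Fin K → EuclideanSpace ℝ (Fin F)} {α β lam ε : ℝ}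
    (hu : ∀ k, ‖u k‖ = 1) (hβ : ∀ i j, i ≠ j → ⟪u i, u j⟫_ℝ = Real.cos β) (hβ0 : 0 ≤ Real.cos β)
    (h1 : 1 < Kmin) (h2 : Kmin ≤ K) (h3 : K ≤ Kmax) (h4 : Kmax < F)
    (hε : SmallEps F K α β lam ε) (hN : 0 < N) {v : Fin N → EuclideanSpace ℝ (Fin F)}
    (hv : ∀ x : EuclideanSpace ℝ (Fin F),
      |∑ n, ⟪v n, x⟫_ℝ ^ 2 - N * secondMoment u α lam x| ≤ N * ε * ‖x‖ ^ 2) :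
    Kmax < (dataMatrix v).rank ∧
      IsGreatest (svRatio (dataMatrix v) '' Set.Icc Kmin Kmax) (svRatio (dataMatrix v) K) ∧
      ratioArgmax (dataMatrix v) Kmin Kmax = {K} := by
  obtain ⟨hε0, hεa, hgap⟩ := hε
  set a := aCoef F α lam with ha
  set b := bCoef F K α lam with hb
  set γ := Real.cos β
  have hN' : (0 : ℝ) < N := by exact_mod_cast hN
  -- The left side of the gap condition exceeds `1`, hence so does the right. Both `γ < 1` and `0 <
  -- b` follow from this.
  have hgap1 : 2 * ε < b * (1 - γ) := by
    have h5 : 1 < (a + ε) / (a - ε) := by rw [one_lt_div (by linarith)]; linarith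
    have h6 := h5.trans hgap
    rw [one_lt_div (by linarith)] at h6
    linarith
  have hγ1 : γ < 1 := lt_of_le_of_ne (Real.cos_le_one β) fun h => by
    rw [h] at hgap1; linarith
  have hb0 : 0 < b := by
    by_contra! h
    nlinarith [mul_nonneg (neg_nonneg.2 h) (sub_nonneg.2 hγ1.le)]
  set δ := b * (1 - γ) with hδ
  set T := Matrix.toEuclideanLin (dataMatrix v) with hT
  have hnorm : ∀ x, ‖LinearMap.adjoint T x‖ ^ 2 = ∑ n, ⟪v n, x⟫_ℝ ^ 2 :=
    norm_adjoint_toEuclideanLin_dataMatrix_sq v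
  have hlo : ∀ x, ∀ m, m * ‖x‖ ^ 2 ≤ secondMoment u α lam x → 0 ≤ m - ε →
      √(N * (m - ε)) * ‖x‖ ≤ ‖LinearMap.adjoint T x‖ := fun x m hm hmε => by
    refine le_of_sq_le_sq ?_ (norm_nonneg _)
    rw [mul_pow, Real.sq_sqrt (by positivity), hnorm]
    have h5 := (abs_le.1 (hv x)).1
    have h6 := mul_le_mul_of_nonneg_left hm hN'.le
    linarith
  have hhi : ∀ x, ∀ m, secondMoment u α lam x ≤ m * ‖x‖ ^ 2 → 0 ≤ m + ε →
      ‖LinearMap.adjoint T x‖ ≤ √(N * (m + ε)) * ‖x‖ := fun x m hm hmε => by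
    refine le_of_sq_le_sq ?_ (by positivity)
    rw [mul_pow, Real.sq_sqrt (by positivity), hnorm]
    have h5 := (abs_le.1 (hv x)).2
    have h6 := mul_le_mul_of_nonneg_left hm hN'.le
    linarith
  have hsm : ∀ x, secondMoment u α lam x = a * ‖x‖ ^ 2 + b * ∑ k, ⟪u k, x⟫_ℝ ^ 2 := fun x => rfl
  have hlow : ∀ i ≤ Kmax, √(N * (a - ε)) ≤ T.singularValues i := fun i hi => by
    refine T.le_singularValues_of_adjoint (Real.sqrt_pos.2 (mul_pos hN' (by linarith))) ⊤ ?_ ?_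
    · rw [finrank_top, finrank_euclideanSpace_fin]; omega
    · intro x _
      refine hlo x a ?_ (by linarith)
      rw [hsm]
      have : 0 ≤ ∑ k, ⟪u k, x⟫_ℝ ^ 2 := Finset.sum_nonneg fun _ _ => sq_nonneg _
      nlinarith [mul_nonneg hb0.le this]
  -- On the common kernel of the `K` functionals `⟪u k, ·⟫` the form is exactly `a ‖x‖²`.
  have hup : ∀ i, K ≤ i → T.singularValues i ≤ √(N * (a + ε)) := fun i hi => by
    refine T.singularValues_le_of_adjoint (Real.sqrt_nonneg _)
      (LinearMap.pi fun k => (innerSL ℝ (u k)).toLinearMap) (by simpa using hi) fun x hx => ?_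
    refine hhi x a ?_ (by linarith)
    have h5 : ∀ k, ⟪u k, x⟫_ℝ = 0 := fun k => by simpa using congrFun hx k
    simp [hsm, h5]
  have hlow' : ∀ i < K, √(N * (a + δ - ε)) ≤ T.singularValues i := fun i hi => by
    refine T.le_singularValues_of_adjoint (Real.sqrt_pos.2 (mul_pos hN' (by linarith)))
      (Submodule.span ℝ (Set.range u)) ?_ ?_
    · rwa [finrank_span_eq_card (linearIndependent_of_equiangular hu hβ hβ0 hγ1), Fintype.card_fin]
    · intro x hx
      refine hlo x (a + δ) ?_ (by linarith)
      rw [hsm]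
      have h5 := le_sum_inner_sq_of_mem_span hu hβ hβ0 hγ1.le hx
      have h6 := mul_le_mul_of_nonneg_left h5 hb0.le
      linarith
  have hup' : ∀ i, 1 ≤ i → T.singularValues i ≤ √(N * (a + δ + ε)) := fun i hi => by
    refine T.singularValues_le_of_adjoint (Real.sqrt_nonneg _)
      (innerSL ℝ (∑ k, u k)).toLinearMap (by simpa using hi) fun x hx => ?_
    refine hhi x (a + δ) ?_ (by linarith)
    rw [hsm]
    have h5 := sum_inner_sq_le_of_inner_sum_eq_zero hu hβ hγ1.le (x := x) hx
    have h6 := mul_le_mul_of_nonneg_left h5 hb0.le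
    linarith
  have hratio : ∀ j ∈ Set.Icc Kmin Kmax, j ≠ K →
      svRatio (dataMatrix v) j < svRatio (dataMatrix v) K := fun j hj hjK => by
    have hq : ∀ p q : ℝ, 0 ≤ p → √(N * p) / √(N * q) = √(p / q) := fun p q hp => by
      rw [← Real.sqrt_div (by positivity), mul_div_mul_left _ _ hN'.ne']
    refine div_succ_lt_of_bounds (L := √(N * (a - ε))) (U := √(N * (a + ε)))
      (L' := √(N * (a + δ - ε))) (U' := √(N * (a + δ + ε)))
      (Real.sqrt_pos.2 (mul_pos hN' (by linarith))) (Real.sqrt_pos.2 (mul_pos hN' (by linarith)))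
      (Real.sqrt_nonneg _) ?_ ?_ h1 h3 hlow hup hlow' hup' hj hjK (by omega)
    · rw [hq _ _ (by linarith), hq _ _ (by linarith)]
      exact Real.sqrt_lt_sqrt (div_nonneg (by linarith) (by linarith)) hgap
    · rw [hq _ _ (by linarith), hq _ _ (by linarith)]
      refine Real.sqrt_le_sqrt ?_
      -- Adding `δ > 0` to numerator and denominator brings a ratio above `1` closer to `1`.
      rw [div_le_div_iff₀ (by linarith) (by linarith)]
      nlinarith
  have hle : ∀ j ∈ Set.Icc Kmin Kmax, svRatio (dataMatrix v) j ≤ svRatio (dataMatrix v) K :=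
    fun j hj => by
      rcases eq_or_ne j K with rfl | h
      · exact le_rfl
      · exact (hratio j hj h).le
  refine ⟨?_, ⟨⟨K, ⟨h2, h3⟩, rfl⟩, ?_⟩, ?_⟩
  · rw [lt_rank_iff_singularValues_pos]
    exact (Real.sqrt_pos.2 (mul_pos hN' (by linarith))).trans_le (hlow Kmax le_rfl)
  · rintro _ ⟨j, hj, rfl⟩
    exact hle j hj
  · ext j
    simp only [ratioArgmax, Set.mem_ofPred_eq, Set.mem_singleton_iff]
    constructor
    · rintro ⟨hj, hmax⟩
      by_contra hjK
      exact absurd (hmax K ⟨h2, h3⟩) (not_le.2 (hratio j hj hjK))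
    · rintro rfl
      exact ⟨⟨h2, h3⟩, hle⟩

end ConeNMF

/-! ### The theorem -/

theorem theorem5 (lam α β : ℝ) (hlam : 0 < lam) (hα : α ∈ Set.Ioo 0 (Real.pi / 2)) :
    ∃ c : ℝ, 0 < c ∧
      ∀ (F K N Kmin Kmax : ℕ) (u : Fin K → EuclideanSpace ℝ (Fin F)) (t ε : ℝ)
        (Ω : Type*) [MeasurableSpace Ω] (μ : Measure Ω) [IsProbabilityMeasure μ]
        (v : Fin N → Ω → EuclideanSpace ℝ (Fin F)),
        (∀ k, ‖u k‖ = 1) →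
        (∀ k, u k ∈ ConeNMF.orthant F) →
        (∀ i j, i ≠ j → Real.arccos (inner ℝ (u i) (u j)) = β) →
        (∀ k, ConeNMF.circularCone (u k) α ⊆ ConeNMF.orthant F) →
        1 < Kmin → Kmin ≤ K → K ≤ Kmax → Kmax < F →
        ConeNMF.IsGenerated μ u (fun _ => α) (fun _ => lam) v →
        1 ≤ t →
        ConeNMF.SmallEps F K α β lam ε →
        c * (t / ε) ^ 2 * (F : ℝ) ≤ (N : ℝ) →
        1 - 2 * ((Kmax : ℝ) - (Kmin : ℝ) + 1) * Real.exp (-(t ^ 2 * (F : ℝ))) ≤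
          μ.real {ω | Kmax < (ConeNMF.dataMatrix fun n => v n ω).rank ∧
            IsGreatest (ConeNMF.svRatio (ConeNMF.dataMatrix fun n => v n ω) ''
                Set.Icc Kmin Kmax)
              (ConeNMF.svRatio (ConeNMF.dataMatrix fun n => v n ω) K) ∧
            ConeNMF.ratioArgmax (ConeNMF.dataMatrix fun n => v n ω) Kmin Kmax = {K}} := by
  refine ⟨24576 / lam ^ 2, by positivity, ?_⟩
  intro F K N Kmin Kmax u t ε Ω _ μ _ v hu horth hβ hcone h1 h2 h3 h4 hv ht hε hN
  have hF : 2 ≤ F := by omega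
  have hK : 2 ≤ K := by omega
  have hcos : ∀ i j, i ≠ j → ⟪u i, u j⟫_ℝ = Real.cos β := fun i j hij => by
    have h5 := abs_le.1 (abs_real_inner_le_norm (u i) (u j))
    rw [hu, hu, one_mul] at h5
    rw [← hβ i j hij, Real.cos_arccos h5.1 h5.2]
  -- Two distinct basis vectors exist since `K ≥ 2`, and vectors of the orthant have nonnegative
  -- inner product.
  have hcos0 : 0 ≤ Real.cos β := by
    rw [← hcos ⟨0, by omega⟩ ⟨1, by omega⟩ (by simp), PiLp.inner_apply]
    exact Finset.sum_nonneg fun i _ => mul_nonneg (horth _ i) (horth _ i)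
  have hε0 := hε.1
  have hεlam : ε * lam ≤ 1 := by
    have h5 := ConeNMF.aCoef_mul_le_half hF hα.1 hα.2 hlam (hε0.trans hε.2.1)
    have h6 := mul_le_mul_of_nonneg_right hε.2.1.le hlam.le
    linarith
  have hN0 : 0 < N := by
    have hF' : (0 : ℝ) < F := by exact_mod_cast (by omega : 0 < F)
    have ht' : 0 < t := by linarith
    have : (0 : ℝ) < N := lt_of_lt_of_le (by positivity) hN
    exact_mod_cast this
  have key := ConeNMF.one_sub_le_measureReal_forall_abs_sum_inner_sq_sub_le hu hF hα.1
    (by linarith [hα.1, hα.2]) hcone hlam (by omega) hv ht hε0 hεlam hN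
  have hsub := measureReal_mono (μ := μ) fun ω hω =>
    ConeNMF.ratioArgmax_eq_of_abs_sum_inner_sq_sub_le hu hcos hcos0 h1 h2 h3 h4 hε hN0
      (v := fun n => v n ω) hω
  -- A single event controls all ratios at once, so the factor `Kmax - Kmin + 1 ≥ 1` is pure slack.
  refine le_trans ?_ (key.trans hsub)
  have h7 : (Kmin : ℝ) ≤ Kmax := by exact_mod_cast h2.trans h3
  nlinarith [Real.exp_pos (-(t ^ 2 * (F : ℝ)))]
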